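/- A (strict) 2-group $\mathfrak G$ is a groupoid object in the category of groups; a morphism of 2-groups is a functor respecting the group structures. Write $G_1$ for its group of objects, $G_2$ for the group of arrows with source the identity object, $\partial\colon G_2\to G_1$ for the target map, and $\alpha^g=g^{-1}\alpha g$ for the right action of $G_1$ on $G_2$, so that $[\partial\colon G_2\to G_1]$ is the associated crossed module. Let $\pi_1\mathfrak G=\operatorname{coker}\partial$ be the group of isomorphism classes of objects and $\pi_2\mathfrak G=\ker\partial$ the abelian group of automorphisms of the identity object. A morphism of 2-groups is an equivalence if it induces isomorphisms on $\pi_1$ and $\pi_2$, and $\mathrm{Ho}(\mathbf{2Gp})$ is obtained from the category of 2-groups by inverting all equivalences. A homotopy class of weak maps $\Gamma\to\mathfrak G$, for a group $\Gamma$, is a morphism in $\mathrm{Ho}(\mathbf{2Gp})$ from $\Gamma$ (viewed as the 2-group $[1\to\Gamma]$ with only identity arrows) to $\mathfrak G$. **Theorem 14.6.** Let $\mathfrak G$ be a 2-group and $\Gamma$ a discrete group. Fix a homomorphism $\chi\colon\Gamma\to\pi_1\mathfrak G$, make $\pi_2\mathfrak G$ into a $\Gamma$-module via $\chi$ (so $\gamma\cdot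 a=gag^{-1}$ for any object $g$ in the class $\chi(\gamma)$), and let $[\Gamma,\mathfrak G]^\chi$ be the set of homotopy classes of weak maps $\Gamma\to\mathfrak G$ inducing $\chi$ on $\pi_1$. Then either $[\Gamma,\mathfrak G]^\chi$ is empty, or it is naturally a transitive $H^2(\Gamma,\pi_2\mathfrak G)$-set. The action is the following one. Consider diagrams $(E,\rho)$, consisting of an extension $1\to G_2\to E\to\Gamma\to1$ and a homomorphism $\rho\colon E\to G_1$ with $\rho|_{G_2}=\partial$ and $\alpha^{\rho(x)}=x^{-1}\alpha x$ for $x\in E$, $\alpha\in G_2$, which induces $\chi$ on $\Gamma=E/G_2\to\pi_1\mathfrak G$. Each one determines a class $[E,\rho]\in[\Gamma,\mathfrak G]^\chi$, namely that of the fraction $\Gamma\xleftarrow{\ \sim\ }[G_2\to E]\xrightarrow{(\mathrm{id},\rho)}\mathfrak G$, and every element of $[\Gamma,\mathfrak G]^\chi$ is of this form. Every element of $H^2(\Gamma,\pi_2\mathfrak G)$ is the class $[K]$ of an extension $1\to\pi_2\mathfrak G\to K\to\Gamma\to1$ inducing the given $\Gamma$-module structure. If $[\Gamma,\mathfrak G]^\chi$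 is not empty, there is an action of $H^2(\Gamma,\pi_2\mathfrak G)$ on it such that: 1. for every diagram $(E_0,\rho_0)$ and every such extension $K$, $[K]\cdot[E_0,\rho_0]=[E_0\times_\Gamma^{\pi_2\mathfrak G}K,\rho]$, where $E_0\times_\Gamma^{\pi_2\mathfrak G}K$ is the quotient of $E_0\times_\Gamma K$ by $\{(a,a):a\in\pi_2\mathfrak G\}$, $G_2$ is embedded by $\alpha\mapsto(\alpha,1)$, and $\rho(x,y)=\rho_0(x)$; 2. for all diagrams $(E_0,\rho_0)$ and $(E,\rho)$, the element $[D]\in H^2(\Gamma,\pi_2\mathfrak G)$ carries $[E_0,\rho_0]$ to $[E,\rho]$, where $D$ is the difference extension: the quotient of $\{(x,y)\in E_0\times E:\bar x=\bar y\in\Gamma,\ \rho_0(x)=\rho(y)\}$ by $\{(\beta,\beta):\beta\in G_2\}$, with $\pi_2\mathfrak G$ embedded by $a\mapsto(a,1)$; 3. the action is transitive. -/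

import Mathlib

universe u

noncomputable section

open CategoryTheory

/-- A (strict) 2-group: a groupoid object in the category of groups. It has a group `Ob` of objects
and a group `Ar` of arrows; source, target and identity are homomorphisms, and composition
(`comp a b` is first `a`, then `b`) is a homomorphism on composable pairs. -/
structure TwoGroup : Type (u + 1) where
  Ob : Type u
  Ar : Type u
  [groupOb : Group Ob]
  [groupAr : Group Ar]
  src : Ar →* Ob
  tgt : Ar →* Ob
  idn : Ob →* Ar
  comp : ∀ a b : Ar, tgt a = src b → Ar
  src_idn : ∀ g, src (idn g) = g
  tgt_idn : ∀ g, tgt (idn g) = g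
  src_comp : ∀ a b h, src (comp a b h) = src a
  tgt_comp : ∀ a b h, tgt (comp a b h) = tgt b
  idn_comp : ∀ a, comp (idn (src a)) a (tgt_idn (src a)) = a
  comp_idn : ∀ a, comp a (idn (tgt a)) (src_idn (tgt a)).symm = a
  comp_assoc : ∀ a b c (h : tgt a = src b) (h' : tgt b = src c),
    comp (comp a b h) c ((tgt_comp a b h).trans h') =
      comp a (comp b c h') (h.trans (src_comp b c h').symm)
  exists_inv : ∀ a, ∃ (b : Ar) (h : tgt a = src b) (h' : tgt b = src a),
    comp a b h = idn (src a) ∧ comp b a h' = idn (tgt a)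
  comp_mul : ∀ a a' b b' (h : tgt a = src b) (h' : tgt a' = src b'),
    comp (a * a') (b * b') (by rw [map_mul, map_mul, h, h']) = comp a b h * comp a' b' h'

namespace TwoGroup

attribute [instance] TwoGroup.groupOb TwoGroup.groupAr

/-- A (strict) morphism of 2-groups: a functor that respects the group operations. -/
@[ext]
structure Hom (G H : TwoGroup.{u}) : Type u where
  onOb : G.Ob →* H.Ob
  onAr : G.Ar →* H.Ar
  src_onAr : ∀ a, H.src (onAr a) = onOb (G.src a)
  tgt_onAr : ∀ a, H.tgt (onAr a) = onOb (G.tgt a)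
  onAr_idn : ∀ g, onAr (G.idn g) = H.idn (onOb g)
  onAr_comp : ∀ a b (h : G.tgt a = G.src b),
    onAr (G.comp a b h) =
      H.comp (onAr a) (onAr b) (by rw [tgt_onAr, src_onAr, h])

/-- The category of 2-groups and strict morphisms. -/
instance : Category TwoGroup.{u} where
  Hom G H := Hom G H
  id G :=
    { onOb := MonoidHom.id _
      onAr := MonoidHom.id _
      src_onAr := fun _ => rfl
      tgt_onAr := fun _ => rfl
      onAr_idn := fun _ => rfl
      onAr_comp := fun _ _ _ => rfl }
  comp f g :=
    { onOb := g.onOb.comp f.onOb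
      onAr := g.onAr.comp f.onAr
      src_onAr := fun a => by simp [g.src_onAr, f.src_onAr]
      tgt_onAr := fun a => by simp [g.tgt_onAr, f.tgt_onAr]
      onAr_idn := fun x => by simp [g.onAr_idn, f.onAr_idn]
      onAr_comp := fun a b h => by simp [g.onAr_comp, f.onAr_comp] }

section basic

variable (G : TwoGroup.{u})

theorem comp_eq (a b : G.Ar) (h : G.tgt a = G.src b) :
    G.comp a b h = b * (G.idn (G.src b))⁻¹ * a := by
  have h1 : G.tgt (1 : G.Ar) = G.src (b * (G.idn (G.src b))⁻¹) := by simp [G.src_idn]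
  have h2 : G.tgt a = G.src (G.idn (G.src b)) := by rw [G.src_idn, h]
  have key := G.comp_mul 1 a (b * (G.idn (G.src b))⁻¹) (G.idn (G.src b)) h1 h2
  have e1 : G.comp 1 (b * (G.idn (G.src b))⁻¹) h1 = b * (G.idn (G.src b))⁻¹ := by
    have := G.idn_comp (b * (G.idn (G.src b))⁻¹)
    convert this using 2
    simp [G.src_idn]
  have e2 : G.comp a (G.idn (G.src b)) h2 = a := by
    have := G.comp_idn a
    convert this using 3
    exact h.symm
  rw [e1, e2] at key
  rw [← key]
  congr 1 <;> simp

/-- Arrows ending at the identity object commute with arrows starting at it. -/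
theorem commute_of_tgt_src (a b : G.Ar) (ha : G.tgt a = 1) (hb : G.src b = 1) : a * b = b * a := by
  have h1 : G.tgt a = G.src (1 : G.Ar) := by simp [ha]
  have h2 : G.tgt (1 : G.Ar) = G.src b := by simp [hb]
  have key := G.comp_mul a 1 1 b h1 h2
  rw [G.comp_eq, G.comp_eq, G.comp_eq] at key
  simp [hb] at key
  exact key.symm

/-- The crossed module of a 2-group in degree two: arrows emanating from the identity object. -/
abbrev G₂ : Subgroup G.Ar := G.src.ker

/-- The structure map `∂` of the crossed module `[G₂ → Ob]`: an arrow goes to its target. -/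
def bd : G.G₂ →* G.Ob := G.tgt.comp G.G₂.subtype

/-- The right action `α ↦ α ^ g = g⁻¹ α g` of objects on `G₂`. -/
def act (α : G.G₂) (g : G.Ob) : G.G₂ :=
  ⟨(G.idn g)⁻¹ * α.1 * G.idn g, by
    have := α.2
    rw [MonoidHom.mem_ker] at this ⊢
    simp [this]⟩

/-- Two objects are isomorphic; this is compatible with the multiplication of objects. -/
def isoCon : Con G.Ob where
  r g h := ∃ a : G.Ar, G.src a = g ∧ G.tgt a = h
  iseqv :=
    { refl := fun g => ⟨G.idn g, G.src_idn g, G.tgt_idn g⟩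
      symm := by
        rintro _ _ ⟨a, rfl, rfl⟩
        obtain ⟨b, h, h', -⟩ := G.exists_inv a
        exact ⟨b, h.symm, h'⟩
      trans := by
        rintro _ _ _ ⟨a, rfl, rfl⟩ ⟨b, hb, rfl⟩
        exact ⟨G.comp a b hb.symm, G.src_comp _ _ _, G.tgt_comp _ _ _⟩ }
  mul' := by
    rintro _ _ _ _ ⟨a, rfl, rfl⟩ ⟨b, rfl, rfl⟩
    exact ⟨a * b, map_mul _ _ _, map_mul _ _ _⟩

/-- `π₁`: the group of isomorphism classes of objects. -/
def π₁ : Type u := G.isoCon.Quotient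

instance : Group G.π₁ := inferInstanceAs (Group G.isoCon.Quotient)

/-- The class in `π₁` of an object. -/
def toπ₁ : G.Ob →* G.π₁ := G.isoCon.mk'

variable {G} in
theorem toπ₁_eq_iff {g h : G.Ob} :
    G.toπ₁ g = G.toπ₁ h ↔ ∃ a : G.Ar, G.src a = g ∧ G.tgt a = h :=
  G.isoCon.eq

theorem toπ₁_surjective : Function.Surjective G.toπ₁ := G.isoCon.mk'_surjective

theorem toπ₁_bd (α : G.G₂) : G.toπ₁ (G.bd α) = 1 := by
  rw [← map_one G.toπ₁, eq_comm, toπ₁_eq_iff]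
  exact ⟨α.1, α.2, rfl⟩

/-- `π₂`: the group of automorphisms of the identity object (on which composition and
multiplication agree). -/
def π₂ : Subgroup G.Ar := G.src.ker ⊓ G.tgt.ker

instance : CommGroup G.π₂ :=
  { (inferInstance : Group G.π₂) with
    mul_comm := fun a b => Subtype.ext (G.commute_of_tgt_src a.1 b.1 a.2.2 b.2.1) }

/-- The inclusion of `π₂` in `G₂`, as the kernel of `∂`. -/
def π₂ToG₂ : G.π₂ →* G.G₂ := Subgroup.inclusion inf_le_left

/-- The left action `a ↦ g a g⁻¹` of objects on `π₂`. -/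
def obActπ₂ : G.Ob →* MulAut G.π₂ where
  toFun g :=
    { toFun := fun a => ⟨G.idn g * a.1 * (G.idn g)⁻¹, by
        have h1 : G.src a.1 = 1 := a.2.1
        have h2 : G.tgt a.1 = 1 := a.2.2
        constructor
        · simp [h1]
        · simp [h2]⟩
      invFun := fun a => ⟨(G.idn g)⁻¹ * a.1 * G.idn g, by
        have h1 : G.src a.1 = 1 := a.2.1
        have h2 : G.tgt a.1 = 1 := a.2.2
        constructor
        · simp [h1]
        · simp [h2]⟩
      left_inv := fun a => Subtype.ext (by simp [mul_assoc])
      right_inv := fun a => Subtype.ext (by simp [mul_assoc])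
      map_mul' := fun a b => Subtype.ext (by simp [mul_assoc]) }
  map_one' := by ext a; simp
  map_mul' g h := by ext a; simp [mul_assoc]

theorem obActπ₂_eq (a : G.π₂) (b : G.Ar) :
    G.idn (G.src b) * a.1 * (G.idn (G.src b))⁻¹ = G.idn (G.tgt b) * a.1 * (G.idn (G.tgt b))⁻¹ := by
  have h1 := G.commute_of_tgt_src a.1 ((G.idn (G.src b))⁻¹ * b) a.2.2 (by simp [G.src_idn])
  have h2 := G.commute_of_tgt_src ((G.idn (G.tgt b))⁻¹ * b) a.1 (by simp [G.tgt_idn]) a.2.1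
  have e1 : G.idn (G.src b) * a.1 * (G.idn (G.src b))⁻¹ = b * a.1 * b⁻¹ := by
    have : a.1 * (G.idn (G.src b))⁻¹ = (G.idn (G.src b))⁻¹ * b * a.1 * b⁻¹ := by
      rw [← h1]; group
    rw [mul_assoc, this]; group
  have e2 : G.idn (G.tgt b) * a.1 * (G.idn (G.tgt b))⁻¹ = b * a.1 * b⁻¹ := by
    have : b * a.1 = G.idn (G.tgt b) * a.1 * ((G.idn (G.tgt b))⁻¹ * b) := by
      rw [mul_assoc, ← h2]; group
    rw [this]; group
  rw [e1, e2]

/-- The left action `[g] • a = g a g⁻¹` of `π₁` on `π₂`. -/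
def actπ₂ : G.π₁ →* MulAut G.π₂ :=
  G.isoCon.lift G.obActπ₂ (by
    rintro _ _ ⟨b, rfl, rfl⟩
    ext a
    exact G.obActπ₂_eq a b)

theorem actπ₂_toπ₁ (g : G.Ob) (a : G.π₂) :
    (G.actπ₂ (G.toπ₁ g) a : G.Ar) = G.idn g * a.1 * (G.idn g)⁻¹ := rfl

end basic

/-- The map induced on `π₁` by a strict morphism. -/
def π₁Map {G H : TwoGroup.{u}} (f : G ⟶ H) : G.π₁ →* H.π₁ :=
  G.isoCon.lift (H.toπ₁.comp (Hom.onOb f)) (by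
    rintro _ _ ⟨a, rfl, rfl⟩
    exact toπ₁_eq_iff.2 ⟨Hom.onAr f a, Hom.src_onAr f a, Hom.tgt_onAr f a⟩)

theorem π₁Map_toπ₁ {G H : TwoGroup.{u}} (f : G ⟶ H) (g : G.Ob) :
    π₁Map f (G.toπ₁ g) = H.toπ₁ (Hom.onOb f g) := rfl

/-- The map induced on `π₂` by a strict morphism. -/
def π₂Map {G H : TwoGroup.{u}} (f : G ⟶ H) : G.π₂ →* H.π₂ :=
  ((Hom.onAr f).comp G.π₂.subtype).codRestrict H.π₂ (by
    rintro ⟨a, h1, h2⟩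
    replace h1 : G.src a = 1 := h1
    replace h2 : G.tgt a = 1 := h2
    constructor
    · change H.src (Hom.onAr f a) = 1
      rw [Hom.src_onAr f, h1, map_one]
    · change H.tgt (Hom.onAr f a) = 1
      rw [Hom.tgt_onAr f, h2, map_one])

/-- Equivalences of 2-groups: the morphisms inducing isomorphisms on `π₁` and `π₂`. -/
def equivalences : MorphismProperty TwoGroup.{u} := fun _ _ f =>
  Function.Bijective (π₁Map f) ∧ Function.Bijective (π₂Map f)

/-- The homotopy category of 2-groups, obtained by formally inverting all equivalences. -/
abbrev Ho : Type (u + 1) := equivalences.{u}.Localization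

/-- The localization functor. -/
abbrev toHo : TwoGroup.{u} ⥤ Ho.{u} := equivalences.{u}.Q

/-- `π₁` as a functor. -/
def π₁Functor : TwoGroup.{u} ⥤ GrpCat.{u} where
  obj G := GrpCat.of G.π₁
  map f := GrpCat.ofHom (π₁Map f)
  map_id G := by
    ext x
    obtain ⟨g, rfl⟩ := G.toπ₁_surjective x
    rfl
  map_comp {G _ _} f g := by
    ext x
    obtain ⟨y, rfl⟩ := G.toπ₁_surjective x
    rfl

theorem π₁Functor_inverts : equivalences.{u}.IsInvertedBy π₁Functor.{u} := fun G H f hf =>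
  (MulEquiv.toGrpIso (X := GrpCat.of G.π₁) (Y := GrpCat.of H.π₁)
    (MulEquiv.ofBijective (π₁Map f) hf.1)).isIso_hom

/-- The functor induced by `π₁` on the homotopy category. -/
def hoπ₁ : Ho.{u} ⥤ GrpCat.{u} := Localization.Construction.lift π₁Functor π₁Functor_inverts

/-- The map induced on `π₁` by a morphism of the homotopy category. -/
def hoπ₁Map {G H : TwoGroup.{u}} (f : toHo.obj G ⟶ toHo.obj H) : G.π₁ →* H.π₁ :=
  (hoπ₁.map f).hom

theorem hoπ₁Map_toHo {G H : TwoGroup.{u}} (f : G ⟶ H) : hoπ₁Map (toHo.map f) = π₁Map f := by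
  have := Functor.congr_hom (Localization.Construction.fac π₁Functor π₁Functor_inverts) f
  have h : (toHo ⋙ hoπ₁).map f = π₁Functor.map f :=
    this.trans ((Category.id_comp _).trans (Category.comp_id _))
  exact congrArg GrpCat.Hom.hom h

theorem hoπ₁Map_comp {G H K : TwoGroup.{u}} (f : toHo.obj G ⟶ toHo.obj H)
    (g : toHo.obj H ⟶ toHo.obj K) : hoπ₁Map (f ≫ g) = (hoπ₁Map g).comp (hoπ₁Map f) := by
  unfold hoπ₁Map
  rw [Functor.map_comp]
  rfl

/-- A group seen as a 2-group with only identity arrows, that is, the crossed module `[1 → Γ]`. -/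
def disc (Γ : Type u) [Group Γ] : TwoGroup.{u} where
  Ob := Γ
  Ar := Γ
  src := MonoidHom.id Γ
  tgt := MonoidHom.id Γ
  idn := MonoidHom.id Γ
  comp a _ _ := a
  src_idn _ := rfl
  tgt_idn _ := rfl
  src_comp _ _ _ := rfl
  tgt_comp _ _ h := h
  idn_comp _ := rfl
  comp_idn _ := rfl
  comp_assoc _ _ _ _ _ := rfl
  exists_inv a := ⟨a, rfl, rfl, rfl, rfl⟩
  comp_mul _ _ _ _ _ _ := rfl

/-- The element of `π₁` of the discrete 2-group `Γ` given by an element of `Γ`. -/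
def discπ₁ {Γ : Type u} [Group Γ] : Γ →* (disc Γ).π₁ := (disc Γ).toπ₁

end TwoGroup

open TwoGroup

variable {Γ : Type u} [Group Γ] {G : TwoGroup.{u}}

/-- The homotopy classes of weak maps from `Γ` to `G` that induce `χ` on `π₁`: the morphisms
from `Γ` to `G` in the homotopy category of 2-groups whose effect on `π₁` is `χ`. -/
def WeakMapClasses (χ : Γ →* G.π₁) : Type (u + 1) :=
  {f : toHo.obj (disc Γ) ⟶ toHo.obj G // ∀ γ : Γ, hoπ₁Map f (discπ₁ γ) = χ γ}

/-- The action of `Γ` on `π₂` via `χ`, written additively. (The ring of integers is moved to the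
universe of `Γ`.) -/
def π₂Representation (χ : Γ →* G.π₁) : Representation (ULift.{u} ℤ) Γ (Additive G.π₂) where
  toFun γ :=
    { toFun := fun a => Additive.ofMul (G.actπ₂ (χ γ) a.toMul)
      map_add' := fun a b => by simp
      map_smul' := fun n a => by
        change Additive.ofMul (G.actπ₂ (χ γ) (a.toMul ^ n.down)) = _
        rw [map_zpow]
        rfl }
  map_one' := by
    refine LinearMap.ext fun a => ?_
    change Additive.ofMul (G.actπ₂ (χ 1) a.toMul) = a
    simp
  map_mul' γ δ := by
    refine LinearMap.ext fun a => ?_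
    change Additive.ofMul (G.actπ₂ (χ (γ * δ)) a.toMul) =
      Additive.ofMul (G.actπ₂ (χ γ) (G.actπ₂ (χ δ) a.toMul))
    simp

/-- `π₂` made into a `Γ`-module via `χ`. -/
abbrev π₂Rep (χ : Γ →* G.π₁) : Rep.{u} (ULift.{u} ℤ) Γ := Rep.of (π₂Representation χ)

/-- The cohomology group `H²(Γ, π₂)`. -/
abbrev H2π₂ (χ : Γ →* G.π₁) : Type u := groupCohomology.H2 (π₂Rep χ)

/-- Extensions `1 → π₂ → K → Γ → 1` whose conjugation action of `Γ` on `π₂` is the one given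
by `χ`. -/
structure ModuleExt (χ : Γ →* G.π₁) : Type (u + 1) where
  K : Type u
  [group : Group K]
  ext : GroupExtension G.π₂ K Γ
  conj : ∀ (x : K) (a : G.π₂),
    ext.inl (G.actπ₂ (χ (ext.rightHom x)) a) = x * ext.inl a * x⁻¹

attribute [instance] ModuleExt.group

/-- Diagrams `(E, ρ)`: an extension `1 → G₂ → E → Γ → 1` with a homomorphism `ρ : E → Ob` that
restricts to `∂` on `G₂`, such that `α ^ ρ(x) = x⁻¹ α x` for `x ∈ E` and `α ∈ G₂`, and such that
the induced homomorphism from `Γ` to `π₁` is `χ`. -/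
structure GExt (χ : Γ →* G.π₁) : Type (u + 1) where
  E : Type u
  [group : Group E]
  ext : GroupExtension G.G₂ E Γ
  ρ : E →* G.Ob
  ρ_inl : ∀ α, ρ (ext.inl α) = G.bd α
  conj : ∀ (x : E) (α : G.G₂), ext.inl (G.act α (ρ x)) = x⁻¹ * ext.inl α * x
  induces : ∀ x : E, G.toπ₁ (ρ x) = χ (ext.rightHom x)

attribute [instance] GExt.group

namespace ModuleExt

variable {χ : Γ →* G.π₁} (X : ModuleExt χ)

/-- A set-theoretic section of `K → Γ`. -/
def sec (γ : Γ) : X.K := Function.surjInv X.ext.rightHom_surjective γ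

theorem rightHom_sec (γ : Γ) : X.ext.rightHom (X.sec γ) = γ :=
  Function.surjInv_eq X.ext.rightHom_surjective γ

theorem exists_factor (g h : Γ) :
    ∃ a : G.π₂, X.ext.inl a * X.sec (g * h) = X.sec g * X.sec h := by
  have : X.sec g * X.sec h * (X.sec (g * h))⁻¹ ∈ X.ext.rightHom.ker := by
    simp [MonoidHom.mem_ker, rightHom_sec]
  rw [← X.ext.range_inl_eq_ker_rightHom] at this
  obtain ⟨a, ha⟩ := this
  exact ⟨a, by rw [ha]; group⟩

/-- The factor set: `s(g) s(h) = f(g, h) s(gh)`. -/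
def factor (g h : Γ) : G.π₂ := (X.exists_factor g h).choose

theorem factor_spec (g h : Γ) :
    X.ext.inl (X.factor g h) * X.sec (g * h) = X.sec g * X.sec h :=
  (X.exists_factor g h).choose_spec

theorem factor_cocycle (g h j : Γ) :
    X.factor (g * h) j * X.factor g h =
      G.actπ₂ (χ g) (X.factor h j) * X.factor g (h * j) := by
  apply X.ext.inl_injective
  have e := X.conj (X.sec g) (X.factor h j)
  rw [rightHom_sec] at e
  rw [mul_comm (X.factor (g * h) j), map_mul, map_mul, e]
  apply mul_right_cancel (b := X.sec (g * h * j))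
  rw [mul_assoc, factor_spec, ← mul_assoc, factor_spec, mul_assoc g h j,
    mul_assoc (X.sec g * X.ext.inl (X.factor h j) * (X.sec g)⁻¹), factor_spec]
  simp only [mul_assoc, inv_mul_cancel_left]
  rw [factor_spec]

/-- The class in `H²(Γ, π₂)` of an extension: the class of its factor set, which does not depend on
the section. -/
def cls : H2π₂ χ :=
  groupCohomology.H2π (π₂Rep χ)
    ⟨fun p => Additive.ofMul (X.factor p.1 p.2),
      (groupCohomology.mem_cocycles₂_iff (A := π₂Rep χ) _).2
        fun g h j => congrArg Additive.ofMul (X.factor_cocycle g h j)⟩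

end ModuleExt

namespace GExt

variable {χ : Γ →* G.π₁} (P : GExt χ)

theorem conj_coe (x : P.E) (α : G.G₂) :
    (P.ext.conjAct x α : G.Ar) = G.idn (P.ρ x) * α.1 * (G.idn (P.ρ x))⁻¹ := by
  have h : P.ext.conjAct x α = G.act α (P.ρ x⁻¹) := by
    apply P.ext.inl_injective
    rw [P.ext.inl_conjAct_comm, P.conj]
    simp
  rw [h]
  simp [TwoGroup.act]

theorem conjAct_inl (α β : G.G₂) : P.ext.conjAct (P.ext.inl α) β = α * β * α⁻¹ := by
  apply P.ext.inl_injective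
  rw [P.ext.inl_conjAct_comm]
  simp

/-- The 2-group of the crossed module `[G₂ → E]`, `E` acting on `G₂` by conjugation: an object is
an element `x` of `E`, and an arrow `(α, x) = α x` goes from `x` to `α x`. -/
def total : TwoGroup.{u} where
  Ob := P.E
  Ar := G.G₂ ⋊[P.ext.conjAct] P.E
  src := SemidirectProduct.rightHom
  tgt := SemidirectProduct.lift P.ext.inl (MonoidHom.id _) (fun x => by
    ext α
    simp [P.ext.inl_conjAct_comm])
  idn := SemidirectProduct.inr
  comp a b _ := ⟨b.left * a.left, a.right⟩
  src_idn _ := rfl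
  tgt_idn g := by simp
  src_comp _ _ _ := rfl
  tgt_comp a b h := by
    simp only [SemidirectProduct.lift, MonoidHom.id_apply, MonoidHom.coe_mk, OneHom.coe_mk,
      SemidirectProduct.rightHom_eq_right] at h ⊢
    rw [map_mul, mul_assoc, h]
  idn_comp a := by ext <;> simp
  comp_idn a := by ext <;> simp
  comp_assoc a b c h h' := by ext <;> simp [mul_assoc]
  exists_inv a := by
    refine ⟨⟨a.left⁻¹, P.ext.inl a.left * a.right⟩, ?_, ?_, ?_, ?_⟩
    · simp [SemidirectProduct.lift]
    · simp [SemidirectProduct.lift]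
    · ext <;> simp
    · ext <;> simp [SemidirectProduct.lift]
  comp_mul a a' b b' h h' := by
    have hb : b.right = P.ext.inl a.left * a.right := by
      simpa [SemidirectProduct.lift] using h.symm
    refine SemidirectProduct.ext ?_ rfl
    simp only [SemidirectProduct.mul_left, hb, map_mul, MulAut.mul_apply, conjAct_inl]
    group

/-- The projection from `[G₂ → E]` to `Γ`. -/
def toDisc : P.total ⟶ disc Γ where
  onOb := P.ext.rightHom
  onAr := P.ext.rightHom.comp SemidirectProduct.rightHom
  src_onAr _ := rfl
  tgt_onAr a := by
    change P.ext.rightHom a.right = P.ext.rightHom (P.ext.inl a.left * a.right)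
    simp
  onAr_idn _ := rfl
  onAr_comp _ _ _ := rfl

/-- The morphism from `[G₂ → E]` to `G` given by the identity of `G₂` and `ρ`. -/
def toG : P.total ⟶ G where
  onOb := P.ρ
  onAr := SemidirectProduct.lift (G.G₂.subtype) (G.idn.comp P.ρ) (fun x => by
    ext α
    simp [P.conj_coe])
  src_onAr a := by
    change G.src (a.left.1 * G.idn (P.ρ a.right)) = P.ρ a.right
    have : G.src a.left.1 = 1 := a.left.2
    simp [this, G.src_idn]
  tgt_onAr a := by
    change G.tgt (a.left.1 * G.idn (P.ρ a.right)) = P.ρ (P.ext.inl a.left * a.right)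
    rw [map_mul, map_mul, P.ρ_inl, G.tgt_idn]
    rfl
  onAr_idn x := by
    exact one_mul (G.idn (P.ρ x))
  onAr_comp a b h := by
    rw [G.comp_eq]
    change (b.left * a.left).1 * G.idn (P.ρ a.right) =
      (b.left.1 * G.idn (P.ρ b.right)) * (G.idn (G.src (b.left.1 * G.idn (P.ρ b.right))))⁻¹ *
        (a.left.1 * G.idn (P.ρ a.right))
    have : G.src b.left.1 = 1 := b.left.2
    rw [map_mul G.src, this, G.src_idn, one_mul]
    simp [mul_assoc]

theorem toDisc_mem : equivalences P.toDisc := by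
  refine ⟨⟨?_, ?_⟩, ⟨?_, ?_⟩⟩
  · intro p q h
    obtain ⟨x, rfl⟩ := P.total.toπ₁_surjective p
    obtain ⟨y, rfl⟩ := P.total.toπ₁_surjective q
    obtain ⟨a, ha, hb⟩ := toπ₁_eq_iff.1 h
    have hxy : P.ext.rightHom x = P.ext.rightHom y := ha.symm.trans hb
    have hk : (show P.E from y) * (show P.E from x)⁻¹ ∈ P.ext.rightHom.ker := by
      rw [MonoidHom.mem_ker, map_mul, map_inv, hxy, mul_inv_cancel]
    rw [← P.ext.range_inl_eq_ker_rightHom] at hk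
    obtain ⟨α, hα⟩ := hk
    refine toπ₁_eq_iff.2 ⟨⟨α, x⟩, rfl, ?_⟩
    change P.ext.inl α * (show P.E from x) = y
    rw [hα, inv_mul_cancel_right]
  · intro q
    obtain ⟨γ, rfl⟩ := (disc Γ).toπ₁_surjective q
    obtain ⟨x, hx⟩ := P.ext.rightHom_surjective γ
    exact ⟨P.total.toπ₁ x, congrArg (disc Γ).toπ₁ hx⟩
  · rintro ⟨a, ha, ha'⟩ ⟨b, hb, hb'⟩ -
    have key : ∀ c : G.G₂ ⋊[P.ext.conjAct] P.E, P.total.src c = 1 → P.total.tgt c = 1 → c = 1 := by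
      intro c h1 h2
      have h1' : c.right = 1 := h1
      have h2' : P.ext.inl c.left * c.right = 1 := h2
      rw [h1', mul_one, map_eq_one_iff _ P.ext.inl_injective] at h2'
      exact SemidirectProduct.ext h2' h1'
    exact Subtype.ext ((key a ha ha').trans (key b hb hb').symm)
  · rintro ⟨c, hc, hc'⟩
    refine ⟨1, ?_⟩
    rw [map_one]
    exact Subtype.ext (show (1 : Γ) = c from (show (c : Γ) = 1 from hc).symm)

/-- The fraction `Γ ← [G₂ → E] → G` in the homotopy category. -/
def hoHom : toHo.obj (disc Γ) ⟶ toHo.obj G :=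
  Localization.Construction.wInv P.toDisc P.toDisc_mem ≫ toHo.map P.toG

/-- The homotopy class of weak maps from `Γ` to `G` given by a diagram `(E, ρ)`. -/
def cls : WeakMapClasses χ :=
  ⟨P.hoHom, fun γ => by
    obtain ⟨x, rfl⟩ := P.ext.rightHom_surjective γ
    have h : toHo.map P.toDisc ≫ P.hoHom = toHo.map P.toG := by
      change (Localization.Construction.wIso P.toDisc P.toDisc_mem).hom ≫
        (Localization.Construction.wIso P.toDisc P.toDisc_mem).inv ≫ _ = _
      rw [Iso.hom_inv_id_assoc]
    have h' := congrArg hoπ₁Map h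
    rw [hoπ₁Map_comp, hoπ₁Map_toHo, hoπ₁Map_toHo] at h'
    exact (DFunLike.congr_fun h' (P.total.toπ₁ x)).trans (P.induces x)⟩

theorem conj_π₂ (x : P.E) (a : G.π₂) :
    P.ext.inl (G.π₂ToG₂ (G.actπ₂ (χ (P.ext.rightHom x)) a)) =
      x * P.ext.inl (G.π₂ToG₂ a) * x⁻¹ := by
  rw [← P.ext.inl_conjAct_comm]
  congr 1
  apply Subtype.ext
  rw [P.conj_coe, ← P.induces]
  rfl

theorem ρ_π₂ (a : G.π₂) : P.ρ (P.ext.inl (G.π₂ToG₂ a)) = 1 := by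
  rw [P.ρ_inl]
  exact a.2.2

section baer

variable (X : ModuleExt χ)

/-- The pairs in `E × K` with the same image in `Γ`. (Their conjugation actions on `π₂` agree, both
being given by `χ`.) -/
def baerPairs : Subgroup (P.E × X.K) :=
  (P.ext.rightHom.comp (MonoidHom.fst _ _)).eqLocus (X.ext.rightHom.comp (MonoidHom.snd _ _))

/-- The diagonal inclusion `a ↦ (a, a)` of `π₂`. -/
def baerDiag : G.π₂ →* P.baerPairs X :=
  ((P.ext.inl.comp G.π₂ToG₂).prod X.ext.inl).codRestrict _ fun a => by
    change P.ext.rightHom (P.ext.inl _) = X.ext.rightHom (X.ext.inl a)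
    simp

instance : (P.baerDiag X).range.Normal where
  conj_mem := by
    rintro _ ⟨a, rfl⟩ ⟨⟨x, y⟩, h⟩
    replace h : P.ext.rightHom x = X.ext.rightHom y := h
    refine ⟨G.actπ₂ (χ (P.ext.rightHom x)) a, Subtype.ext (Prod.ext ?_ ?_)⟩
    · exact P.conj_π₂ x a
    · change X.ext.inl _ = _
      rw [h]
      exact X.conj y a

/-- The inclusion `α ↦ (α, 1)` of `G₂` in the pairs. -/
def baerInl : G.G₂ →* P.baerPairs X :=
  (P.ext.inl.prod 1).codRestrict _ fun α => by
    change P.ext.rightHom (P.ext.inl α) = X.ext.rightHom 1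
    simp

/-- The Baer product of an extension `E` of `Γ` by `G₂` and an extension `K` of `Γ` by `π₂`, with
underlying group the quotient of the fibre product of `E` and `K` over `Γ` by the diagonal `π₂`;
`G₂` is included by `α ↦ (α, 1)` and the homomorphism to `Ob` is `(x, y) ↦ ρ(x)`. -/
def baer : GExt χ where
  E := P.baerPairs X ⧸ (P.baerDiag X).range
  ext :=
    { inl := (QuotientGroup.mk' _).comp (P.baerInl X)
      rightHom := QuotientGroup.lift _
        ((P.ext.rightHom.comp (MonoidHom.fst _ _)).comp (P.baerPairs X).subtype) (by
          rintro _ ⟨a, rfl⟩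
          exact P.ext.rightHom_inl _)
      inl_injective := by
        rw [injective_iff_map_eq_one]
        intro α hα
        obtain ⟨a, ha⟩ := (QuotientGroup.eq_one_iff _).1 hα
        have h1 : P.ext.inl (G.π₂ToG₂ a) = P.ext.inl α := congrArg (fun p => p.1.1) ha
        have h2 : X.ext.inl a = 1 := congrArg (fun p => p.1.2) ha
        rw [map_eq_one_iff _ X.ext.inl_injective] at h2
        rw [h2, map_one] at h1
        exact (P.ext.inl_injective h1).symm
      range_inl_eq_ker_rightHom := by
        apply le_antisymm
        · rintro _ ⟨α, rfl⟩
          exact P.ext.rightHom_inl α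
        · intro q hq
          obtain ⟨⟨⟨x, y⟩, h⟩, rfl⟩ := QuotientGroup.mk_surjective q
          replace h : P.ext.rightHom x = X.ext.rightHom y := h
          have hx : x ∈ P.ext.rightHom.ker := hq
          have hy : y ∈ X.ext.rightHom.ker := h.symm.trans hq
          rw [← P.ext.range_inl_eq_ker_rightHom] at hx
          rw [← X.ext.range_inl_eq_ker_rightHom] at hy
          obtain ⟨α, rfl⟩ := hx
          obtain ⟨a, rfl⟩ := hy
          refine ⟨α * (G.π₂ToG₂ a)⁻¹, QuotientGroup.eq.2 ⟨a, ?_⟩⟩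
          refine Subtype.ext (Prod.ext ?_ ?_)
          · change P.ext.inl (G.π₂ToG₂ a) = (P.ext.inl (α * (G.π₂ToG₂ a)⁻¹))⁻¹ * P.ext.inl α
            simp
          · change X.ext.inl a = 1⁻¹ * X.ext.inl a
            simp
      rightHom_surjective := fun γ => by
        obtain ⟨x, hx⟩ := P.ext.rightHom_surjective γ
        obtain ⟨y, hy⟩ := X.ext.rightHom_surjective γ
        exact ⟨QuotientGroup.mk ⟨(x, y), hx.trans hy.symm⟩, hx⟩ }
  ρ := QuotientGroup.lift _ ((P.ρ.comp (MonoidHom.fst _ _)).comp (P.baerPairs X).subtype) (by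
    rintro _ ⟨a, rfl⟩
    exact P.ρ_π₂ a)
  ρ_inl α := P.ρ_inl α
  conj q α := by
    obtain ⟨⟨⟨x, y⟩, h⟩, rfl⟩ := QuotientGroup.mk_surjective q
    refine congrArg (QuotientGroup.mk (s := (P.baerDiag X).range))
      (Subtype.ext (Prod.ext (P.conj x α) ?_) :
        P.baerInl X (G.act α (P.ρ x)) = ⟨(x, y), h⟩⁻¹ * P.baerInl X α * ⟨(x, y), h⟩)
    change (1 : X.K) = y⁻¹ * 1 * y
    simp
  induces q := by
    obtain ⟨⟨⟨x, y⟩, h⟩, rfl⟩ := QuotientGroup.mk_surjective q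
    exact P.induces x

end baer

section difference

variable (Q : GExt χ)

/-- The pairs `(x, y)` in `E × E'` with the same image in `Γ` and with `ρ(x) = ρ'(y)`. -/
def diffPairs : Subgroup (P.E × Q.E) :=
  ((P.ext.rightHom.prod P.ρ).comp (MonoidHom.fst _ _)).eqLocus
    ((Q.ext.rightHom.prod Q.ρ).comp (MonoidHom.snd _ _))

/-- The diagonal inclusion `α ↦ (α, α)` of `G₂`. -/
def diffDiag : G.G₂ →* P.diffPairs Q :=
  (P.ext.inl.prod Q.ext.inl).codRestrict _ fun α => by
    refine Prod.ext ?_ ?_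
    · change P.ext.rightHom (P.ext.inl α) = Q.ext.rightHom (Q.ext.inl α)
      simp
    · change P.ρ (P.ext.inl α) = Q.ρ (Q.ext.inl α)
      rw [P.ρ_inl, Q.ρ_inl]

theorem conj_inv (x : P.E) (α : G.G₂) :
    P.ext.inl (G.act α (P.ρ x)⁻¹) = x * P.ext.inl α * x⁻¹ := by
  rw [← map_inv, P.conj, inv_inv]

instance : (P.diffDiag Q).range.Normal where
  conj_mem := by
    rintro _ ⟨α, rfl⟩ ⟨⟨x, y⟩, h⟩
    have h' : P.ρ x = Q.ρ y := congrArg Prod.snd h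
    refine ⟨G.act α (P.ρ x)⁻¹, Subtype.ext (Prod.ext ?_ ?_)⟩
    · exact P.conj_inv x α
    · change Q.ext.inl _ = _
      rw [h']
      exact Q.conj_inv y α

/-- The inclusion `a ↦ (a, 1)` of `π₂` in the pairs. -/
def diffInl : G.π₂ →* P.diffPairs Q :=
  ((P.ext.inl.comp G.π₂ToG₂).prod 1).codRestrict _ fun a => by
    refine Prod.ext ?_ ?_
    · change P.ext.rightHom (P.ext.inl _) = Q.ext.rightHom 1
      simp
    · change P.ρ (P.ext.inl (G.π₂ToG₂ a)) = Q.ρ 1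
      rw [P.ρ_π₂, map_one]

/-- The difference of two diagrams `(E, ρ)` and `(E', ρ')`: the extension of `Γ` by `π₂` whose
underlying group is the quotient, by the diagonal `G₂`, of the group of pairs `(x, y)` in `E × E'`
with the same image in `Γ` and with `ρ(x) = ρ'(y)`; `π₂` is included by `a ↦ (a, 1)`. -/
def difference : ModuleExt χ where
  K := P.diffPairs Q ⧸ (P.diffDiag Q).range
  ext :=
    { inl := (QuotientGroup.mk' _).comp (P.diffInl Q)
      rightHom := QuotientGroup.lift _
        ((P.ext.rightHom.comp (MonoidHom.fst _ _)).comp (P.diffPairs Q).subtype) (by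
          rintro _ ⟨α, rfl⟩
          exact P.ext.rightHom_inl _)
      inl_injective := by
        rw [injective_iff_map_eq_one]
        intro a ha
        obtain ⟨α, hα⟩ := (QuotientGroup.eq_one_iff _).1 ha
        have h1 : P.ext.inl α = P.ext.inl (G.π₂ToG₂ a) := congrArg (fun p => p.1.1) hα
        have h2 : Q.ext.inl α = 1 := congrArg (fun p => p.1.2) hα
        rw [map_eq_one_iff _ Q.ext.inl_injective] at h2
        rw [h2] at h1
        have h3 := P.ext.inl_injective h1
        exact Subtype.ext (congrArg Subtype.val h3).symm
      range_inl_eq_ker_rightHom := by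
        apply le_antisymm
        · rintro _ ⟨a, rfl⟩
          exact P.ext.rightHom_inl _
        · intro q hq
          obtain ⟨⟨⟨x, y⟩, h⟩, rfl⟩ := QuotientGroup.mk_surjective q
          have h1 : P.ext.rightHom x = Q.ext.rightHom y := congrArg Prod.fst h
          have h2 : P.ρ x = Q.ρ y := congrArg Prod.snd h
          have hx : x ∈ P.ext.rightHom.ker := hq
          have hy : y ∈ Q.ext.rightHom.ker := h1.symm.trans hq
          rw [← P.ext.range_inl_eq_ker_rightHom] at hx
          rw [← Q.ext.range_inl_eq_ker_rightHom] at hy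
          obtain ⟨α, rfl⟩ := hx
          obtain ⟨β, rfl⟩ := hy
          rw [P.ρ_inl, Q.ρ_inl] at h2
          have h3 : G.tgt (α * β⁻¹).1 = 1 := by
            change G.bd (α * β⁻¹) = 1
            rw [map_mul, map_inv, h2, mul_inv_cancel]
          refine ⟨⟨(α * β⁻¹).1, (α * β⁻¹).2, h3⟩, QuotientGroup.eq.2 ⟨β, ?_⟩⟩
          refine Subtype.ext (Prod.ext ?_ ?_)
          · change P.ext.inl β = (P.ext.inl (α * β⁻¹))⁻¹ * P.ext.inl α
            simp
          · change Q.ext.inl β = 1⁻¹ * Q.ext.inl β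
            simp
      rightHom_surjective := fun γ => by
        obtain ⟨x, hx⟩ := P.ext.rightHom_surjective γ
        obtain ⟨y, hy⟩ := Q.ext.rightHom_surjective γ
        have h : G.toπ₁ (Q.ρ y) = G.toπ₁ (P.ρ x) := by rw [P.induces, Q.induces, hx, hy]
        obtain ⟨b, hb, hb'⟩ := toπ₁_eq_iff.1 h
        let α : G.G₂ := ⟨b * (G.idn (Q.ρ y))⁻¹, by
          rw [MonoidHom.mem_ker, map_mul, map_inv, G.src_idn, hb, mul_inv_cancel]⟩
        have hα : G.bd α = P.ρ x * (Q.ρ y)⁻¹ := by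
          change G.tgt (b * (G.idn (Q.ρ y))⁻¹) = _
          rw [map_mul, map_inv, G.tgt_idn, hb']
        refine ⟨QuotientGroup.mk ⟨(x, Q.ext.inl α * y), Prod.ext ?_ ?_⟩, hx⟩
        · change P.ext.rightHom x = Q.ext.rightHom (Q.ext.inl α * y)
          simp [hx, hy]
        · change P.ρ x = Q.ρ (Q.ext.inl α * y)
          rw [map_mul, Q.ρ_inl, hα, inv_mul_cancel_right] }
  conj q a := by
    obtain ⟨⟨⟨x, y⟩, h⟩, rfl⟩ := QuotientGroup.mk_surjective q
    refine congrArg (QuotientGroup.mk (s := (P.diffDiag Q).range))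
      (Subtype.ext (Prod.ext (P.conj_π₂ x a) ?_) :
        P.diffInl Q (G.actπ₂ (χ (P.ext.rightHom x)) a) =
          ⟨(x, y), h⟩ * P.diffInl Q a * ⟨(x, y), h⟩⁻¹)
    change (1 : Q.E) = y * 1 * y⁻¹
    simp

end difference

end GExt

end

/-! Morphisms out of `Γ` in the homotopy category are computed by a free resolution. Let `F` be the
free group on the set `Γ`; the resolution has `F` as its group of objects and exactly one arrow
between any two elements with the same image in `Γ`, so it is equivalent to `Γ`. Equivalences are
fully faithful and essentially surjective and `F` is free, hence morphisms from the resolution lift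
along equivalences up to homotopy, and so do homotopies (`exists_lift_resolution`,
`exists_homotopy_of_comp`). Homotopy classes of such morphisms therefore form a functor that inverts
equivalences and extends to `Ho`. Homotopic morphisms become equal in `Ho` by a path object argument
(`Homotopy.toHo_eq`), and a Yoneda argument then identifies this functor with Hom out of `Γ`
(`exists_fraction`, `homotopy_of_fraction_eq`).

A morphism from the resolution yields a diagram (`ofResolution`), so every class has the form `[E,
ρ]`. Conversely a homotopy between the morphisms coming from two diagrams can be read as a map `E →
E'`, and two diagrams have the same class exactly when they are isomorphic (`cls_eq_of_twisted_one`,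
`twisted_one_of_cls_eq`).

What remains is the theory of extensions. `Twisted f P Q` is isomorphism of diagrams up to a factor
`f` with values in `π₂`. Such maps compose, with factors multiplied, can be inverted, and can be
altered by any coboundary, so only the class of `f` in `H²` matters. The Baer product and the
difference extension are both instances, with factor set that of `K` and of `D` respectively
(`twisted_baer`, `twisted_difference`). Thus a class `c` carries each diagram to some diagram, any
two diagrams are related by some `c`, and the class of the target depends only on `c` and the class
of the source (`Carries.cls_eq`). This gives the action, both formulas and transitivity. -/

noncomputable section

open CategoryTheory TwoGroup

variable {Γ : Type u} [Group Γ] {G : TwoGroup.{u}}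

namespace TwoGroup

/-! ### Composition and inversion of arrows as group-theoretic formulas -/

section calculus

variable (G)

/-- Composition of arrows, first `a` and then `b`, as a total operation given by the formula that
holds on composable pairs. -/
def cmp (a b : G.Ar) : G.Ar := b * (G.idn (G.src b))⁻¹ * a

/-- The interchange law for the total operation. It needs composability, whereas associativity and
the right unit law are identities in the group of arrows that hold for all arrows. -/
theorem cmp_mul {a a' b b' : G.Ar} (h : G.tgt a = G.src b) (h' : G.tgt a' = G.src b') :
    G.cmp (a * a') (b * b') = G.cmp a b * G.cmp a' b' := by
  have key := G.comp_mul a a' b b' h h'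
  rwa [comp_eq, comp_eq, comp_eq] at key

@[simp]
theorem src_cmp (a b : G.Ar) : G.src (G.cmp a b) = G.src a := by
  simp [cmp, G.src_idn]

theorem tgt_cmp {a b : G.Ar} (h : G.tgt a = G.src b) : G.tgt (G.cmp a b) = G.tgt b := by
  simp [cmp, G.tgt_idn, h]

theorem cmp_assoc (a b c : G.Ar) : G.cmp (G.cmp a b) c = G.cmp a (G.cmp b c) := by
  simp [cmp, G.src_idn, mul_assoc]

theorem idn_cmp {a : G.Ar} {g : G.Ob} (h : g = G.src a) : G.cmp (G.idn g) a = a := by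
  simp [cmp, h]

theorem cmp_idn (a : G.Ar) (g : G.Ob) : G.cmp a (G.idn g) = a := by
  simp [cmp, G.src_idn]

theorem cmp_left_cancel {a b c : G.Ar} (hs : G.src b = G.src c) (h : G.cmp a b = G.cmp a c) :
    b = c := by
  unfold cmp at h
  rw [hs] at h
  exact mul_right_cancel (mul_right_cancel h)

theorem cmp_right_cancel {a b c : G.Ar} (h : G.cmp a c = G.cmp b c) : a = b :=
  mul_left_cancel h

/-- The inverse of an arrow for composition. -/
def inv (a : G.Ar) : G.Ar := G.idn (G.src a) * a⁻¹ * G.idn (G.tgt a)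

@[simp]
theorem src_inv (a : G.Ar) : G.src (G.inv a) = G.tgt a := by simp [inv, G.src_idn]

@[simp]
theorem tgt_inv (a : G.Ar) : G.tgt (G.inv a) = G.src a := by simp [inv, G.tgt_idn]

theorem inv_cmp (a : G.Ar) : G.cmp (G.inv a) a = G.idn (G.tgt a) := by simp [cmp, inv, mul_assoc]

theorem cmp_inv (a : G.Ar) : G.cmp a (G.inv a) = G.idn (G.src a) := by simp [cmp, inv, G.src_idn]

/-- By interchange both sides are right inverses of `a * b` for composition, and composition can be
cancelled on the left. -/
theorem inv_mul (a b : G.Ar) : G.inv (a * b) = G.inv a * G.inv b := by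
  apply G.cmp_left_cancel (a := a * b) (by simp)
  rw [cmp_inv, G.cmp_mul (by simp) (by simp), cmp_inv, cmp_inv, map_mul, map_mul]

/-- The inverse for composition, as a homomorphism. -/
def invHom : G.Ar →* G.Ar := MonoidHom.mk' G.inv G.inv_mul

variable {G}

theorem Hom.onAr_cmp {H : TwoGroup.{u}} (f : G ⟶ H) (a b : G.Ar) :
    Hom.onAr f (G.cmp a b) = H.cmp (Hom.onAr f a) (Hom.onAr f b) := by
  simp [cmp, Hom.onAr_idn f, Hom.src_onAr f]

theorem Hom.onAr_inv {H : TwoGroup.{u}} (f : G ⟶ H) (a : G.Ar) :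
    Hom.onAr f (G.inv a) = H.inv (Hom.onAr f a) := by
  simp [inv, Hom.onAr_idn f, Hom.src_onAr f, Hom.tgt_onAr f]

/-- Compatibility with composition is automatic. -/
def Hom.mk' {G H : TwoGroup.{u}} (onOb : G.Ob →* H.Ob) (onAr : G.Ar →* H.Ar)
    (hs : ∀ a, H.src (onAr a) = onOb (G.src a)) (ht : ∀ a, H.tgt (onAr a) = onOb (G.tgt a))
    (hi : ∀ g, onAr (G.idn g) = H.idn (onOb g)) : G ⟶ H :=
  show Hom G H from
  { onOb, onAr
    src_onAr := hs
    tgt_onAr := ht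
    onAr_idn := hi
    onAr_comp := fun a b _ => by
      rw [comp_eq, comp_eq, map_mul, map_mul, map_inv, hi, hs] }

theorem hom_ext {G H : TwoGroup.{u}} {f g : G ⟶ H} (h : Hom.onOb f = Hom.onOb g)
    (h' : Hom.onAr f = Hom.onAr g) : f = g := Hom.ext h h'

end calculus

/-! ### Homotopies of morphisms -/

/-- Natural transformations, compatible with the group operations, between morphisms of
2-groups. -/
structure Homotopy {G H : TwoGroup.{u}} (f f' : G ⟶ H) where
  arr : G.Ob →* H.Ar
  src_arr : ∀ x, H.src (arr x) = Hom.onOb f x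
  tgt_arr : ∀ x, H.tgt (arr x) = Hom.onOb f' x
  naturality : ∀ c, H.cmp (Hom.onAr f c) (arr (G.tgt c)) = H.cmp (arr (G.src c)) (Hom.onAr f' c)

namespace Homotopy

variable {H K : TwoGroup.{u}} {f f' f'' : G ⟶ H}

/-- The identity homotopy. -/
def refl (f : G ⟶ H) : Homotopy f f where
  arr := H.idn.comp (Hom.onOb f)
  src_arr _ := H.src_idn _
  tgt_arr _ := H.tgt_idn _
  naturality c := by
    change H.cmp _ (H.idn _) = H.cmp (H.idn _) _
    rw [cmp_idn, idn_cmp _ (Hom.src_onAr f c).symm]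

/-- The inverse homotopy. -/
def symm (θ : Homotopy f f') : Homotopy f' f where
  arr := H.invHom.comp θ.arr
  src_arr x := (H.src_inv _).trans (θ.tgt_arr x)
  tgt_arr x := (H.tgt_inv _).trans (θ.src_arr x)
  naturality c := by
    change H.cmp _ (H.inv _) = H.cmp (H.inv _) _
    apply H.cmp_right_cancel (c := θ.arr (G.tgt c))
    rw [cmp_assoc, cmp_assoc, inv_cmp, θ.naturality, cmp_idn, ← cmp_assoc, inv_cmp, idn_cmp]
    rw [θ.tgt_arr, Hom.src_onAr f']

/-- The composition of homotopies. -/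
def trans (θ : Homotopy f f') (θ' : Homotopy f' f'') : Homotopy f f'' where
  arr := MonoidHom.mk' (fun x => H.cmp (θ.arr x) (θ'.arr x)) fun x y => by
    rw [map_mul, map_mul, H.cmp_mul] <;> rw [θ.tgt_arr, θ'.src_arr]
  src_arr x := (H.src_cmp _ _).trans (θ.src_arr x)
  tgt_arr x := (H.tgt_cmp ((θ.tgt_arr x).trans (θ'.src_arr x).symm)).trans (θ'.tgt_arr x)
  naturality c := by
    change H.cmp _ (H.cmp _ _) = H.cmp (H.cmp _ _) _
    rw [← cmp_assoc, θ.naturality, cmp_assoc, θ'.naturality, cmp_assoc]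

/-- The composition of a homotopy with a morphism. -/
def whiskerRight (θ : Homotopy f f') (g : H ⟶ K) : Homotopy (f ≫ g) (f' ≫ g) where
  arr := (Hom.onAr g).comp θ.arr
  src_arr x := (Hom.src_onAr g _).trans (congrArg (Hom.onOb g) (θ.src_arr x))
  tgt_arr x := (Hom.tgt_onAr g _).trans (congrArg (Hom.onOb g) (θ.tgt_arr x))
  naturality c := by
    change K.cmp (Hom.onAr g _) (Hom.onAr g _) = K.cmp (Hom.onAr g _) (Hom.onAr g _)
    rw [← Hom.onAr_cmp, ← Hom.onAr_cmp, θ.naturality]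

end Homotopy

/-! ### The path object, and equality of homotopic morphisms in `Ho` -/

section path

variable (G)

/-- The commutative squares in a 2-group: `((a, b), (u, v))` is a square with vertical sides `a` and
`b`, top `u : src a → src b` and bottom `v : tgt a → tgt b`. -/
def squares : Subgroup ((G.Ar × G.Ar) × (G.Ar × G.Ar)) where
  carrier := {s | G.src s.2.1 = G.src s.1.1 ∧ G.tgt s.2.1 = G.src s.1.2 ∧
    G.src s.2.2 = G.tgt s.1.1 ∧ G.tgt s.2.2 = G.tgt s.1.2 ∧
    G.cmp s.1.1 s.2.2 = G.cmp s.2.1 s.1.2}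
  one_mem' := by simp
  mul_mem' := by
    rintro ⟨⟨a, b⟩, ⟨x, y⟩⟩ ⟨⟨a', b'⟩, ⟨x', y'⟩⟩ ⟨h1, h2, h3, h4, h5⟩ ⟨h1', h2', h3', h4', h5'⟩
    dsimp only at *
    refine ⟨?_, ?_, ?_, ?_, ?_⟩
    · simp_all
    · simp_all
    · simp_all
    · simp_all
    · change G.cmp (a * a') (y * y') = G.cmp (x * x') (b * b')
      rw [G.cmp_mul h3.symm h3'.symm, G.cmp_mul h2 h2', h5, h5']
  inv_mem' := by
    rintro ⟨⟨a, b⟩, ⟨x, y⟩⟩ ⟨h1, h2, h3, h4, h5⟩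
    dsimp only at *
    refine ⟨?_, ?_, ?_, ?_, ?_⟩
    · simp_all
    · simp_all
    · simp_all
    · simp_all
    · change G.cmp a⁻¹ y⁻¹ = G.cmp x⁻¹ b⁻¹
      have e1 := G.cmp_mul (a := a) (a' := a⁻¹) (b := y) (b' := y⁻¹) h3.symm (by simp [h3])
      have e2 := G.cmp_mul (a := x) (a' := x⁻¹) (b := b) (b' := b⁻¹) h2 (by simp [h2])
      simp only [mul_inv_cancel] at e1 e2
      apply mul_left_cancel (a := G.cmp a y)
      rw [← e1, h5, ← e2]

/-- The 2-group of arrows and commutative squares. -/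
def path : TwoGroup.{u} where
  Ob := G.Ar
  Ar := G.squares
  src := ((MonoidHom.fst _ _).comp (MonoidHom.fst _ _)).comp G.squares.subtype
  tgt := ((MonoidHom.snd _ _).comp (MonoidHom.fst _ _)).comp G.squares.subtype
  idn := (((MonoidHom.id _).prod (MonoidHom.id _)).prod
    ((G.idn.comp G.src).prod (G.idn.comp G.tgt))).codRestrict _ fun a => by
      refine ⟨G.src_idn _, G.tgt_idn _, G.src_idn _, G.tgt_idn _, ?_⟩
      exact (G.cmp_idn _ _).trans (G.idn_cmp rfl).symm
  comp s t h := ⟨((s.1.1.1, t.1.1.2), (G.cmp s.1.2.1 t.1.2.1, G.cmp s.1.2.2 t.1.2.2)), by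
    obtain ⟨⟨⟨a, b⟩, ⟨x, y⟩⟩, h1, h2, h3, h4, h5⟩ := s
    obtain ⟨⟨⟨a', b'⟩, ⟨x', y'⟩⟩, h1', h2', h3', h4', h5'⟩ := t
    obtain rfl : b = a' := h
    dsimp only at *
    refine ⟨(G.src_cmp _ _).trans h1, (G.tgt_cmp (h2.trans h1'.symm)).trans h2',
      (G.src_cmp _ _).trans h3, (G.tgt_cmp (h4.trans h3'.symm)).trans h4', ?_⟩
    change G.cmp a (G.cmp y y') = G.cmp (G.cmp x x') b'
    rw [← cmp_assoc, h5, cmp_assoc, h5', cmp_assoc]⟩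
  src_idn _ := rfl
  tgt_idn _ := rfl
  src_comp _ _ _ := rfl
  tgt_comp _ _ _ := rfl
  idn_comp s := by
    obtain ⟨⟨⟨a, b⟩, ⟨x, y⟩⟩, h1, h2, h3, h4, h5⟩ := s
    exact Subtype.ext (Prod.ext rfl (Prod.ext (G.idn_cmp h1.symm) (G.idn_cmp h3.symm)))
  comp_idn s := by
    obtain ⟨⟨⟨a, b⟩, ⟨x, y⟩⟩, h1, h2, h3, h4, h5⟩ := s
    exact Subtype.ext (Prod.ext rfl (Prod.ext (G.cmp_idn _ _) (G.cmp_idn _ _)))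
  comp_assoc _ _ _ _ _ :=
    Subtype.ext (Prod.ext rfl (Prod.ext (G.cmp_assoc _ _ _) (G.cmp_assoc _ _ _)))
  exists_inv s := by
    obtain ⟨⟨⟨a, b⟩, ⟨x, y⟩⟩, h1, h2, h3, h4, h5⟩ := s
    dsimp only at *
    refine ⟨⟨((b, a), (G.inv x, G.inv y)), (G.src_inv _).trans h2, (G.tgt_inv _).trans h1,
      (G.src_inv _).trans h4, (G.tgt_inv _).trans h3, ?_⟩, rfl, rfl, ?_, ?_⟩
    · change G.cmp b (G.inv y) = G.cmp (G.inv x) a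
      apply G.cmp_right_cancel (c := y)
      rw [cmp_assoc, cmp_assoc, inv_cmp, h5, cmp_idn, ← cmp_assoc, inv_cmp, idn_cmp _ h2]
    · refine Subtype.ext (Prod.ext rfl (Prod.ext ?_ ?_))
      · exact (G.cmp_inv x).trans (congrArg G.idn h1)
      · exact (G.cmp_inv y).trans (congrArg G.idn h3)
    · refine Subtype.ext (Prod.ext rfl (Prod.ext ?_ ?_))
      · exact (G.inv_cmp x).trans (congrArg G.idn h2)
      · exact (G.inv_cmp y).trans (congrArg G.idn h4)
  comp_mul s s' t t' h h' := by
    obtain ⟨⟨⟨a, b⟩, ⟨x, y⟩⟩, h1, h2, h3, h4, h5⟩ := s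
    obtain ⟨⟨⟨a', b'⟩, ⟨x', y'⟩⟩, h1', h2', h3', h4', h5'⟩ := s'
    obtain ⟨⟨⟨c, d⟩, ⟨z, w⟩⟩, k1, k2, k3, k4, k5⟩ := t
    obtain ⟨⟨⟨c', d'⟩, ⟨z', w'⟩⟩, k1', k2', k3', k4', k5'⟩ := t'
    obtain rfl : b = c := h
    obtain rfl : b' = c' := h'
    refine Subtype.ext (Prod.ext rfl (Prod.ext ?_ ?_))
    · exact G.cmp_mul (h2.trans k1.symm) (h2'.trans k1'.symm)
    · exact G.cmp_mul (h4.trans k3.symm) (h4'.trans k3'.symm)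

/-- The source of a path. -/
def pathSrc : G.path ⟶ G :=
  Hom.mk' G.src (((MonoidHom.fst _ _).comp (MonoidHom.snd _ _)).comp G.squares.subtype)
    (fun s => s.2.1) (fun s => s.2.2.1) (fun _ => rfl)

/-- The target of a path. -/
def pathTgt : G.path ⟶ G :=
  Hom.mk' G.tgt (((MonoidHom.snd _ _).comp (MonoidHom.snd _ _)).comp G.squares.subtype)
    (fun s => s.2.2.2.1) (fun s => s.2.2.2.2.1) (fun _ => rfl)

/-- The constant paths. -/
def pathConst : G ⟶ G.path :=
  Hom.mk' G.idn
    ((((G.idn.comp G.src).prod (G.idn.comp G.tgt)).prod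
      ((MonoidHom.id _).prod (MonoidHom.id _))).codRestrict G.squares fun a => by
        refine ⟨(G.src_idn _).symm, (G.src_idn _).symm, (G.tgt_idn _).symm, (G.tgt_idn _).symm, ?_⟩
        exact (G.idn_cmp rfl).trans (G.cmp_idn _ _).symm)
    (fun _ => rfl) (fun _ => rfl) (fun g => Subtype.ext (by
      change ((G.idn (G.src (G.idn g)), G.idn (G.tgt (G.idn g))), (G.idn g, G.idn g)) =
        ((G.idn g, G.idn g), (G.idn (G.src (G.idn g)), G.idn (G.tgt (G.idn g))))
      rw [G.src_idn, G.tgt_idn]))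

theorem pathConst_pathSrc : G.pathConst ≫ G.pathSrc = 𝟙 G :=
  hom_ext (MonoidHom.ext G.src_idn) rfl

theorem pathConst_pathTgt : G.pathConst ≫ G.pathTgt = 𝟙 G :=
  hom_ext (MonoidHom.ext G.tgt_idn) rfl

/-- An arrow `a`, as an object of the path 2-group, is joined to the constant path at its source by
the square with top an identity and bottom `a`. A square between constant paths has a top arrow
joining their base points. A square with trivial vertical sides has equal top and bottom, which
settles `π₂`. -/
theorem pathConst_mem : equivalences G.pathConst := by
  refine ⟨⟨?_, ?_⟩, ⟨?_, ?_⟩⟩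
  · intro p q h
    obtain ⟨x, rfl⟩ := G.toπ₁_surjective p
    obtain ⟨y, rfl⟩ := G.toπ₁_surjective q
    obtain ⟨⟨s, hs⟩, h1, h2⟩ := toπ₁_eq_iff.1 h
    replace h1 : s.1.1 = G.idn x := h1
    replace h2 : s.1.2 = G.idn y := h2
    refine toπ₁_eq_iff.2 ⟨s.2.1, ?_, ?_⟩
    · rw [hs.1, h1, G.src_idn]
    · rw [hs.2.1, h2, G.src_idn]
  · intro q
    obtain ⟨a, rfl⟩ := G.path.toπ₁_surjective q
    refine ⟨G.toπ₁ (G.src a), toπ₁_eq_iff.2 ⟨⟨((G.idn (G.src a), a), (G.idn (G.src a), a)),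
      rfl, G.tgt_idn _, (G.tgt_idn _).symm, rfl, ?_⟩, rfl, rfl⟩⟩
    rfl
  · intro a b h
    exact Subtype.ext (congrArg (fun s => s.1.1.2.1) h)
  · rintro ⟨⟨⟨⟨a, b⟩, ⟨x, y⟩⟩, h1, h2, h3, h4, h5⟩, ha, hb⟩
    obtain rfl : a = 1 := ha
    obtain rfl : b = 1 := hb
    have hxy : y = x := by
      have e1 := G.idn_cmp (a := y) (g := 1) (h3.trans (map_one _)).symm
      have e2 := G.cmp_idn x 1
      rw [map_one] at e1 e2
      exact e1.symm.trans (h5.trans e2)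
    subst hxy
    refine ⟨⟨y, h1.trans (map_one _), h2.trans (map_one _)⟩, Subtype.ext (Subtype.ext ?_)⟩
    refine Prod.ext (Prod.ext ?_ ?_) rfl
    · exact (congrArg G.idn (h1.trans (map_one _))).trans (map_one _)
    · exact (congrArg G.idn (h2.trans (map_one _))).trans (map_one _)

/-- Both ends are retractions of the constant paths, which become invertible in `Ho`. -/
theorem toHo_pathSrc : toHo.map G.pathSrc = toHo.map G.pathTgt := by
  have : IsIso (toHo.map G.pathConst) := Localization.inverts toHo equivalences _ G.pathConst_mem
  rw [← cancel_epi (toHo.map G.pathConst), ← Functor.map_comp, ← Functor.map_comp,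
    pathConst_pathSrc, pathConst_pathTgt]

end path

/-- A homotopy is a morphism to the path 2-group: its components are the images of objects and its
naturality squares the images of arrows. The two ends of the path 2-group agree in `Ho`. -/
theorem Homotopy.toHo_eq {G H : TwoGroup.{u}} {f f' : G ⟶ H} (θ : Homotopy f f') :
    toHo.map f = toHo.map f' := by
  let h : G ⟶ H.path := Hom.mk' θ.arr
    ((((θ.arr.comp G.src).prod (θ.arr.comp G.tgt)).prod
      ((Hom.onAr f).prod (Hom.onAr f'))).codRestrict H.squares fun c => by
        refine ⟨(Hom.src_onAr f c).trans (θ.src_arr _).symm,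
          (Hom.tgt_onAr f c).trans (θ.src_arr _).symm,
          (Hom.src_onAr f' c).trans (θ.tgt_arr _).symm,
          (Hom.tgt_onAr f' c).trans (θ.tgt_arr _).symm, (θ.naturality c).symm⟩)
    (fun _ => rfl) (fun _ => rfl) (fun g => Subtype.ext (by
      change ((θ.arr (G.src (G.idn g)), θ.arr (G.tgt (G.idn g))),
        (Hom.onAr f (G.idn g), Hom.onAr f' (G.idn g))) =
        ((θ.arr g, θ.arr g), (H.idn (H.src (θ.arr g)), H.idn (H.tgt (θ.arr g))))
      rw [G.src_idn, G.tgt_idn, θ.src_arr, θ.tgt_arr, Hom.onAr_idn f, Hom.onAr_idn f']))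
  have e1 : h ≫ H.pathSrc = f := hom_ext (MonoidHom.ext θ.src_arr) rfl
  have e2 : h ≫ H.pathTgt = f' := hom_ext (MonoidHom.ext θ.tgt_arr) rfl
  rw [← e1, ← e2, Functor.map_comp, Functor.map_comp, toHo_pathSrc]

end TwoGroup

namespace TwoGroup

/-! ### Equivalences are fully faithful and essentially surjective -/

section equivalence

variable {H : TwoGroup.{u}} {w : G ⟶ H}

/-- The quotient of two parallel arrows lies in `π₂`, where `w` is injective. -/
theorem equivalences.arrow_injective (hw : equivalences w) {a a' : G.Ar} (hs : G.src a = G.src a')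
    (ht : G.tgt a = G.tgt a') (h : Hom.onAr w a = Hom.onAr w a') : a = a' := by
  let k : G.π₂ := ⟨a * a'⁻¹, by simp [hs], by simp [ht]⟩
  have hk : k = 1 := by
    apply hw.2.1
    rw [map_one]
    refine Subtype.ext ?_
    change Hom.onAr w (a * a'⁻¹) = 1
    rw [map_mul, map_inv, h, mul_inv_cancel]
  exact mul_inv_eq_one.1 (congrArg Subtype.val hk)

/-- Injectivity on `π₁` supplies some arrow with the right ends; surjectivity on `π₂` corrects its
image to the prescribed one. -/
theorem equivalences.exists_arrow (hw : equivalences w) {g g' : G.Ob} {b : H.Ar}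
    (hs : H.src b = Hom.onOb w g) (ht : H.tgt b = Hom.onOb w g') :
    ∃ a, G.src a = g ∧ G.tgt a = g' ∧ Hom.onAr w a = b := by
  obtain ⟨a, rfl, rfl⟩ := toπ₁_eq_iff.1 (hw.1.1 (toπ₁_eq_iff.2 ⟨b, hs, ht⟩) :
    G.toπ₁ g = G.toπ₁ g')
  obtain ⟨k, hk⟩ := hw.2.2 ⟨(Hom.onAr w a)⁻¹ * b,
    by simp [Hom.src_onAr w, hs], by simp [Hom.tgt_onAr w, ht]⟩
  have hk' : Hom.onAr w k.1 = (Hom.onAr w a)⁻¹ * b := congrArg Subtype.val hk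
  have h1 : G.src k.1 = 1 := k.2.1
  have h2 : G.tgt k.1 = 1 := k.2.2
  refine ⟨a * k.1, by rw [map_mul, h1, mul_one], by rw [map_mul, h2, mul_one], ?_⟩
  rw [map_mul, hk', mul_inv_cancel_left]

theorem equivalences.exists_object (hw : equivalences w) (h : H.Ob) :
    ∃ (g : G.Ob) (b : H.Ar), H.src b = Hom.onOb w g ∧ H.tgt b = h := by
  obtain ⟨p, hp⟩ := hw.1.2 (H.toπ₁ h)
  obtain ⟨g, rfl⟩ := G.toπ₁_surjective p
  exact ⟨g, toπ₁_eq_iff.1 hp⟩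

end equivalence

/-! ### The 2-group of a homomorphism with its kernel pair as arrows -/

section kerPair

variable {E : Type u} [Group E]

/-- The 2-group with group of objects `E` and with exactly one arrow between any two elements of `E`
that have the same image under `π`. -/
def kerPair (π : E →* Γ) : TwoGroup.{u} where
  Ob := E
  Ar := (π.comp (MonoidHom.fst E E)).eqLocus (π.comp (MonoidHom.snd E E))
  src := (MonoidHom.fst E E).comp (Subgroup.subtype _)
  tgt := (MonoidHom.snd E E).comp (Subgroup.subtype _)
  idn := ((MonoidHom.id E).prod (MonoidHom.id E)).codRestrict _ fun _ => rfl
  comp a b h := ⟨(a.1.1, b.1.2), a.2.trans ((congrArg π h).trans b.2)⟩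
  src_idn _ := rfl
  tgt_idn _ := rfl
  src_comp _ _ _ := rfl
  tgt_comp _ _ _ := rfl
  idn_comp _ := rfl
  comp_idn _ := rfl
  comp_assoc _ _ _ _ _ := rfl
  exists_inv a := ⟨⟨(a.1.2, a.1.1), a.2.symm⟩, rfl, rfl, rfl, rfl⟩
  comp_mul _ _ _ _ _ _ := rfl

theorem kerPair_ext {π : E →* Γ} {c d : (kerPair π).Ar} (hs : (kerPair π).src c = (kerPair π).src d)
    (ht : (kerPair π).tgt c = (kerPair π).tgt d) : c = d :=
  Subtype.ext (Prod.ext hs ht)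

/-- The arrow between two elements with the same image. -/
def kerPairArrow {π : E →* Γ} {x y : E} (h : π x = π y) : (kerPair π).Ar := ⟨(x, y), h⟩

theorem map_src_eq_map_tgt {π : E →* Γ} (c : (kerPair π).Ar) :
    π ((kerPair π).src c) = π ((kerPair π).tgt c) := c.2

/-- The projection of `kerPair π` to the discrete 2-group. -/
def kerPairToDisc (π : E →* Γ) : kerPair π ⟶ disc Γ :=
  Hom.mk' π (π.comp (kerPair π).src) (fun _ => rfl) (fun c => map_src_eq_map_tgt c) (fun _ => rfl)

theorem kerPairToDisc_mem {π : E →* Γ} (hπ : Function.Surjective π) :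
    equivalences (kerPairToDisc π) := by
  refine ⟨⟨?_, ?_⟩, ⟨?_, ?_⟩⟩
  · intro p q h
    obtain ⟨x, rfl⟩ := (kerPair π).toπ₁_surjective p
    obtain ⟨y, rfl⟩ := (kerPair π).toπ₁_surjective q
    obtain ⟨a, ha, hb⟩ := toπ₁_eq_iff.1 h
    exact toπ₁_eq_iff.2 ⟨kerPairArrow (ha.symm.trans hb), rfl, rfl⟩
  · intro q
    obtain ⟨γ, rfl⟩ := (disc Γ).toπ₁_surjective q
    obtain ⟨x, hx⟩ := hπ γ
    exact ⟨(kerPair π).toπ₁ x, congrArg (disc Γ).toπ₁ hx⟩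
  · rintro a b -
    exact Subtype.ext (kerPair_ext (a.2.1.trans b.2.1.symm) (a.2.2.trans b.2.2.symm))
  · rintro ⟨c, hc, hc'⟩
    refine ⟨1, ?_⟩
    rw [map_one]
    exact Subtype.ext (show (1 : Γ) = c from (show (c : Γ) = 1 from hc).symm)

end kerPair

/-! ### The free resolution and lifting along equivalences -/

section resolution

/-- The canonical homomorphism to a group from the free group on its underlying set. -/
abbrev freeProj (Γ : Type u) [Group Γ] : FreeGroup Γ →* Γ := FreeGroup.lift id

theorem freeProj_surjective : Function.Surjective (freeProj Γ) := fun γ =>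
  ⟨FreeGroup.of γ, FreeGroup.lift_apply_of⟩

/-- The resolution of the discrete 2-group `Γ` by free groups. -/
abbrev resolution (Γ : Type u) [Group Γ] : TwoGroup.{u} := kerPair (freeProj Γ)

/-- The projection of the resolution. -/
abbrev resolutionToDisc (Γ : Type u) [Group Γ] : resolution Γ ⟶ disc Γ :=
  kerPairToDisc (freeProj Γ)

theorem resolutionToDisc_mem : equivalences (resolutionToDisc Γ) :=
  kerPairToDisc_mem freeProj_surjective

/-- The free generators of the group of objects of the resolution. -/
def gen (γ : Γ) : (resolution Γ).Ob := FreeGroup.of γ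

/-- The homomorphism on the group of objects of the resolution given by its values on the
generators. -/
def genLift {K : Type u} [Group K] (k : Γ → K) : (resolution Γ).Ob →* K := FreeGroup.lift k

@[simp]
theorem genLift_gen {K : Type u} [Group K] (k : Γ → K) (γ : Γ) : genLift k (gen γ) = k γ :=
  FreeGroup.lift_apply_of

theorem freeProj_gen (γ : Γ) : freeProj Γ (gen γ) = γ := FreeGroup.lift_apply_of

theorem eq_of_gen {K : Type u} [Group K] {f f' : (resolution Γ).Ob →* K}
    (h : ∀ γ, f (gen γ) = f' (gen γ)) (x : (resolution Γ).Ob) : f x = f' x :=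
  DFunLike.congr_fun (FreeGroup.ext_hom f f' h) x

variable {H : TwoGroup.{u}} {w : G ⟶ H}

/-- Essential surjectivity gives an object and a connecting arrow for each generator, and freeness
extends both to homomorphisms. The values on arrows are then forced by full faithfulness, so no
freeness is required of the group of arrows, and multiplicativity follows from uniqueness. -/
theorem exists_lift_resolution (hw : equivalences w) (q : resolution Γ ⟶ H) :
    ∃ p : resolution Γ ⟶ G, Nonempty (Homotopy (p ≫ w) q) := by
  choose g b hb hb' using fun γ : Γ => hw.exists_object (Hom.onOb q (gen γ))
  let p₀ : (resolution Γ).Ob →* G.Ob := genLift g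
  let β : (resolution Γ).Ob →* H.Ar := genLift b
  have hβs : ∀ x, H.src (β x) = Hom.onOb w (p₀ x) := eq_of_gen (f := (H.src.comp β)) (f' := ((Hom.onOb w).comp p₀))
    fun γ => by simp [β, p₀, hb]
  have hβt : ∀ x, H.tgt (β x) = Hom.onOb q x := eq_of_gen (f := (H.tgt.comp β)) (f' := (Hom.onOb q))
    fun γ => by simp [β, hb']
  -- The only possible image of the lift of `c` under `w` if `β` is to be natural: `q c` conjugated
  -- by `β`.
  let t (c : (resolution Γ).Ar) : H.Ar :=
    H.cmp (H.cmp (β ((resolution Γ).src c)) (Hom.onAr q c)) (H.inv (β ((resolution Γ).tgt c)))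
  have c1 : ∀ c, H.tgt (β ((resolution Γ).src c)) = H.src (Hom.onAr q c) := fun c => by
    rw [hβt, Hom.src_onAr q]
  have c2 : ∀ c, H.tgt (H.cmp (β ((resolution Γ).src c)) (Hom.onAr q c)) =
      H.src (H.inv (β ((resolution Γ).tgt c))) := fun c => by
    rw [H.tgt_cmp (c1 c), src_inv, hβt, Hom.tgt_onAr q]
  have ht : ∀ c c', t (c * c') = t c * t c' := fun c c' => by
    simp only [t, map_mul, inv_mul]
    rw [H.cmp_mul (c1 c) (c1 c'), H.cmp_mul (c2 c) (c2 c')]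
  choose a has hat haw using fun c : (resolution Γ).Ar => hw.exists_arrow
    (g := p₀ ((resolution Γ).src c)) (g' := p₀ ((resolution Γ).tgt c)) (b := t c)
    (by rw [src_cmp, src_cmp, hβs]) (by rw [H.tgt_cmp (c2 c), tgt_inv, hβs])
  refine ⟨Hom.mk' p₀ (MonoidHom.mk' a fun c c' => hw.arrow_injective ?_ ?_ ?_) has hat fun x =>
    hw.arrow_injective ?_ ?_ ?_, ⟨⟨β, hβs, hβt, fun c => ?_⟩⟩⟩
  · simp only [map_mul, has]
  · simp only [map_mul, hat]
  · simp only [map_mul, haw, ht]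
  · exact (has _).trans (G.src_idn _).symm
  · exact (hat _).trans (G.tgt_idn _).symm
  · change Hom.onAr w (a _) = _
    rw [haw, Hom.onAr_idn w, ← hβs]
    simp only [t, src_idn, tgt_idn, Hom.onAr_idn q, cmp_idn, cmp_inv]
  · change H.cmp (Hom.onAr w (a c)) _ = _
    rw [haw, cmp_assoc, inv_cmp, cmp_idn]

/-- The components at generators lift by fullness and extend by freeness; naturality may be tested
after applying the faithful `w`. -/
theorem exists_homotopy_of_comp (hw : equivalences w) {p p' : resolution Γ ⟶ G}
    (θ : Homotopy (p ≫ w) (p' ≫ w)) : Nonempty (Homotopy p p') := by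
  choose a has hat haw using fun γ : Γ => hw.exists_arrow (θ.src_arr (gen γ))
    (θ.tgt_arr (gen γ))
  let η : (resolution Γ).Ob →* G.Ar := genLift a
  have hηs : ∀ x, G.src (η x) = Hom.onOb p x := eq_of_gen (f := (G.src.comp η)) (f' := (Hom.onOb p))
    fun γ => by simp [η, has]
  have hηt : ∀ x, G.tgt (η x) = Hom.onOb p' x := eq_of_gen (f := (G.tgt.comp η)) (f' := (Hom.onOb p'))
    fun γ => by simp [η, hat]
  have hηw : ∀ x, Hom.onAr w (η x) = θ.arr x := eq_of_gen (f := ((Hom.onAr w).comp η)) (f' := θ.arr)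
    fun γ => by simp [η, haw]
  refine ⟨⟨η, hηs, hηt, fun c => hw.arrow_injective ?_ ?_ ?_⟩⟩
  · rw [src_cmp, src_cmp, hηs, Hom.src_onAr p]
  · rw [G.tgt_cmp, G.tgt_cmp, hηt, Hom.tgt_onAr p']
    · rw [hηt, Hom.src_onAr p']
    · rw [hηs, Hom.tgt_onAr p]
  · rw [Hom.onAr_cmp, Hom.onAr_cmp, hηw, hηw]
    exact θ.naturality c

variable (Γ) in
/-- Homotopy of morphisms from the resolution of `Γ`. -/
def homotopySetoid (G : TwoGroup.{u}) : Setoid (resolution Γ ⟶ G) where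
  r f f' := Nonempty (Homotopy f f')
  iseqv :=
    { refl := fun f => ⟨Homotopy.refl f⟩
      symm := fun ⟨θ⟩ => ⟨θ.symm⟩
      trans := fun ⟨θ⟩ ⟨θ'⟩ => ⟨θ.trans θ'⟩ }

variable (Γ) in
/-- The functor of homotopy classes of morphisms from the resolution of `Γ`. -/
def homotopyClasses : TwoGroup.{u} ⥤ Type (u + 1) where
  -- Raised to the universe of the Hom-sets of `Ho`, for comparison with a corepresentable functor.
  obj G := ULift.{u + 1} (Quotient (homotopySetoid Γ G))
  map w := TypeCat.ofHom fun x => ⟨x.down.map (· ≫ w) fun _ _ (h : Nonempty _) =>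
    h.map fun θ => θ.whiskerRight w⟩
  map_id G := by
    ext ⟨x⟩
    induction x using Quotient.inductionOn
    rfl
  map_comp v w := by
    ext ⟨x⟩
    induction x using Quotient.inductionOn
    rfl

theorem homotopyClasses_inverts : equivalences.{u}.IsInvertedBy (homotopyClasses Γ) := by
  intro G H w hw
  rw [isIso_iff_bijective]
  constructor
  · rintro ⟨x⟩ ⟨y⟩ h
    induction x using Quotient.inductionOn with | _ p
    induction y using Quotient.inductionOn with | _ p'
    obtain ⟨θ⟩ := Quotient.exact (congrArg ULift.down h)
    exact congrArg ULift.up (Quotient.sound (exists_homotopy_of_comp hw θ))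
  · rintro ⟨y⟩
    induction y using Quotient.inductionOn with | _ q
    obtain ⟨p, hp⟩ := exists_lift_resolution hw q
    exact ⟨⟨Quotient.mk _ p⟩, congrArg ULift.up (Quotient.sound hp)⟩

/-! ### Morphisms in `Ho` with discrete source -/

/-- The functor on the homotopy category induced by `homotopyClasses`. -/
def hoHomotopyClasses (Γ : Type u) [Group Γ] : Ho.{u} ⥤ Type (u + 1) :=
  Localization.Construction.lift (homotopyClasses Γ) homotopyClasses_inverts

/-- The homotopy class of a morphism from the resolution. -/
def homotopyClass (q : resolution Γ ⟶ G) : (hoHomotopyClasses Γ).obj (toHo.obj G) :=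
  ULift.up (Quotient.mk (homotopySetoid Γ G) q)

theorem hoHomotopyClasses_map {H : TwoGroup.{u}} (w : G ⟶ H) (q : resolution Γ ⟶ G) :
    (hoHomotopyClasses Γ).map (toHo.map w) (homotopyClass q) = homotopyClass (q ≫ w) := by
  have := Functor.congr_hom
    (Localization.Construction.fac (homotopyClasses Γ) homotopyClasses_inverts) w
  have h : (toHo ⋙ hoHomotopyClasses Γ).map w = (homotopyClasses Γ).map w :=
    this.trans ((Category.id_comp _).trans (Category.comp_id _))
  exact DFunLike.congr_fun (congrArg TypeCat.Hom.hom h) (homotopyClass q)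

/-- The fraction `Γ ← E → G` in the homotopy category given by an equivalence `s` and a
morphism `q`. -/
def fraction {E : TwoGroup.{u}} {s : E ⟶ disc Γ} (hs : equivalences s) (q : E ⟶ G) :
    toHo.obj (disc Γ) ⟶ toHo.obj G :=
  Localization.Construction.wInv s hs ≫ toHo.map q

theorem toHo_comp_fraction {E : TwoGroup.{u}} {s : E ⟶ disc Γ} (hs : equivalences s) (q : E ⟶ G) :
    toHo.map s ≫ fraction hs q = toHo.map q := by
  change (Localization.Construction.wIso s hs).hom ≫
    (Localization.Construction.wIso s hs).inv ≫ _ = _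
  rw [Iso.hom_inv_id_assoc]

theorem fraction_eq_iff {E : TwoGroup.{u}} {s : E ⟶ disc Γ} (hs : equivalences s) (q : E ⟶ G)
    (f : toHo.obj (disc Γ) ⟶ toHo.obj G) : fraction hs q = f ↔ toHo.map q = toHo.map s ≫ f := by
  constructor
  · rintro rfl
    rw [toHo_comp_fraction]
  · intro h
    change (Localization.Construction.wIso s hs).inv ≫ _ = _
    rw [h, Iso.inv_comp_eq]
    rfl

/-- The fraction given by a homotopy class of morphisms from the resolution. -/
def classToHoApp (x : (hoHomotopyClasses Γ).obj (toHo.obj G)) :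
    toHo.obj (disc Γ) ⟶ toHo.obj G :=
  Quotient.lift (s := homotopySetoid Γ G) (fraction resolutionToDisc_mem)
    (fun _ _ h => h.elim fun θ => congrArg (_ ≫ ·) θ.toHo_eq) (ULift.down x)

theorem exists_homotopyClass (x : (hoHomotopyClasses Γ).obj (toHo.obj G)) :
    ∃ q, x = homotopyClass q := by
  obtain ⟨q, hq⟩ := Quotient.exists_rep (ULift.down x)
  exact ⟨q, congrArg ULift.up hq.symm⟩

/-- The naturality of `classToHoApp` with respect to morphisms of 2-groups. -/
def classToHoAux (Γ : Type u) [Group Γ] :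
    toHo ⋙ hoHomotopyClasses Γ ⟶ toHo ⋙ coyoneda.obj (Opposite.op (toHo.obj (disc Γ))) where
  app G := TypeCat.ofHom (classToHoApp (G := G))
  naturality G H w := by
    ext x
    obtain ⟨q, rfl⟩ := exists_homotopyClass x
    refine (congrArg (classToHoApp (G := H)) (hoHomotopyClasses_map w q)).trans ?_
    change _ ≫ toHo.map (q ≫ w) = (_ ≫ toHo.map q) ≫ toHo.map w
    rw [Functor.map_comp, Category.assoc]

/-- The map from homotopy classes of morphisms from the resolution to morphisms in the homotopy
category. -/
def classToHo (Γ : Type u) [Group Γ] :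
    hoHomotopyClasses Γ ⟶ coyoneda.obj (Opposite.op (toHo.obj (disc Γ))) :=
  Localization.Construction.natTransExtension (classToHoAux Γ)

theorem classToHo_homotopyClass (q : resolution Γ ⟶ G) :
    (classToHo Γ).app (toHo.obj G) (homotopyClass q) = fraction resolutionToDisc_mem q := by
  have h : (classToHo Γ).app (toHo.obj G) = (classToHoAux Γ).app G :=
    Localization.Construction.NatTransExtension.app_eq (classToHoAux Γ) G
  rw [h]
  rfl

/-- Every morphism in the homotopy category with discrete source is a fraction whose denominator is
the resolution. -/
theorem exists_fraction (f : toHo.obj (disc Γ) ⟶ toHo.obj G) :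
    ∃ q : resolution Γ ⟶ G, fraction resolutionToDisc_mem q = f := by
  -- The Yoneda argument: naturality at `f`, evaluated at the class of the projection, whose
  -- associated fraction is the identity of `Γ`.
  have key := DFunLike.congr_fun (congrArg TypeCat.Hom.hom ((classToHo Γ).naturality f))
    (homotopyClass (resolutionToDisc Γ))
  obtain ⟨q, hq⟩ :=
    exists_homotopyClass ((hoHomotopyClasses Γ).map f (homotopyClass (resolutionToDisc Γ)))
  refine ⟨q, ?_⟩
  rw [← classToHo_homotopyClass]
  have e : fraction resolutionToDisc_mem (resolutionToDisc Γ) = 𝟙 _ := by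
    rw [fraction_eq_iff, Category.comp_id]
  refine (congrArg ((classToHo Γ).app (toHo.obj G)) hq).symm.trans (key.trans ?_)
  change (classToHo Γ).app (toHo.obj (disc Γ)) (homotopyClass (resolutionToDisc Γ)) ≫ f = f
  rw [classToHo_homotopyClass, e, Category.id_comp]

/-- Morphisms from the resolution that agree in the homotopy category are homotopic. -/
theorem homotopy_of_fraction_eq {q q' : resolution Γ ⟶ G}
    (h : fraction resolutionToDisc_mem q = fraction resolutionToDisc_mem q') :
    Nonempty (Homotopy q q') := by
  -- A fraction remembers the homotopy class of its numerator: it sends the class of the projection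
  -- to that of `q`.
  have key : ∀ q : resolution Γ ⟶ G, (hoHomotopyClasses Γ).map (fraction resolutionToDisc_mem q)
      (homotopyClass (resolutionToDisc Γ)) = homotopyClass q := fun q => by
    have e := hoHomotopyClasses_map (resolutionToDisc Γ) (𝟙 _)
    rw [Category.id_comp] at e
    rw [← e, ← Functor.map_comp_apply, toHo_comp_fraction, hoHomotopyClasses_map,
      Category.id_comp]
  have e := (key q).symm.trans ((congrArg (fun f => (hoHomotopyClasses Γ).map f
    (homotopyClass (resolutionToDisc Γ))) h).trans (key q'))
  exact Quotient.exact (congrArg ULift.down e)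

end resolution

end TwoGroup

namespace GExt

/-! ### From a morphism of the resolution to a diagram -/

section ofResolution

variable {χ : Γ →* G.π₁} (q : resolution Γ ⟶ G)

/-- The pairs of an object `x` of the resolution and an arrow starting at `q x`. -/
def mappingPairs : Subgroup ((resolution Γ).Ob × G.Ar) :=
  ((Hom.onOb q).comp (MonoidHom.fst _ _)).eqLocus (G.src.comp (MonoidHom.snd _ _))

/-- The arrows of the resolution that end at the identity, as pairs. -/
def mappingRel : (resolution Γ).tgt.ker →* mappingPairs q :=
  (((resolution Γ).src.prod (Hom.onAr q)).comp (Subgroup.subtype _)).codRestrict _ fun c =>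
    (Hom.src_onAr q c.1).symm

theorem mem_range_mappingRel {p : mappingPairs q} :
    p ∈ (mappingRel q).range ↔
      ∃ c, (resolution Γ).tgt c = 1 ∧ (resolution Γ).src c = p.1.1 ∧ Hom.onAr q c = p.1.2 := by
  constructor
  · rintro ⟨c, rfl⟩
    exact ⟨c.1, c.2, rfl, rfl⟩
  · rintro ⟨c, h, h1, h2⟩
    exact ⟨⟨c, h⟩, Subtype.ext (Prod.ext h1 h2)⟩

instance : (mappingRel q).range.Normal where
  conj_mem := by
    intro p hp ⟨⟨y, b⟩, h⟩
    obtain ⟨c, h1, h2, h3⟩ := (mem_range_mappingRel q).1 hp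
    replace h : Hom.onOb q y = G.src b := h
    refine (mem_range_mappingRel q).2
      ⟨(resolution Γ).idn y * c * ((resolution Γ).idn y)⁻¹, ?_, ?_, ?_⟩
    · simp [h1, (resolution Γ).tgt_idn]
    · rw [map_mul, map_mul, map_inv, (resolution Γ).src_idn, h2]
      rfl
    · rw [map_mul, map_mul, map_inv, Hom.onAr_idn q, h]
      have hc : G.tgt (Hom.onAr q c) = 1 := by rw [Hom.tgt_onAr q, h1, map_one]
      -- `q c` ends at the identity object, so conjugating it by `b` or by the identity arrow of
      -- `src b` gives the same result.
      have key := G.commute_of_tgt_src (Hom.onAr q c) ((G.idn (G.src b))⁻¹ * b) hc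
        (by simp [G.src_idn])
      change _ = b * p.1.2 * b⁻¹
      rw [← h3, eq_mul_inv_iff_mul_eq, mul_assoc, mul_assoc, key]
      simp [mul_assoc]

/-- The diagram of a morphism `q` from the resolution of `Γ`: its underlying group consists of the
pairs of an object `x` of the resolution and an arrow starting at `q x`, modulo the arrows of the
resolution. -/
def ofResolution (hq : ∀ x, G.toπ₁ (Hom.onOb q x) = χ (freeProj Γ x)) : GExt χ where
  E := mappingPairs q ⧸ (mappingRel q).range
  ext :=
    { inl := (QuotientGroup.mk' _).comp (((1 : G.G₂ →* (resolution Γ).Ob).prod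
        G.G₂.subtype).codRestrict (mappingPairs q) fun α =>
          (map_one (Hom.onOb q)).trans (MonoidHom.mem_ker.1 α.2).symm)
      rightHom := QuotientGroup.lift _
        (((freeProj Γ).comp (MonoidHom.fst (resolution Γ).Ob G.Ar)).comp
          (mappingPairs q).subtype) (by
            rintro _ ⟨c, rfl⟩
            exact (map_src_eq_map_tgt c.1).trans
              ((congrArg (freeProj Γ) (MonoidHom.mem_ker.1 c.2)).trans (map_one _)))
      inl_injective := by
        rw [injective_iff_map_eq_one]
        intro α hα
        obtain ⟨c, h1, h2, h3⟩ := (mem_range_mappingRel q).1 ((QuotientGroup.eq_one_iff _).1 hα)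
        -- Both ends of `c` are trivial, and the resolution has at most one arrow between two
        -- objects.
        have hc : c = 1 := kerPair_ext (h2.trans (map_one _).symm) (h1.trans (map_one _).symm)
        rw [hc, map_one] at h3
        exact Subtype.ext h3.symm
      range_inl_eq_ker_rightHom := by
        apply le_antisymm
        · rintro _ ⟨α, rfl⟩
          exact map_one (freeProj Γ)
        · intro p hp
          obtain ⟨⟨⟨x, a⟩, h⟩, rfl⟩ := QuotientGroup.mk_surjective p
          replace h : Hom.onOb q x = G.src a := h
          replace hp : freeProj Γ x = 1 := hp
          -- As `x` lies over `1`, there is an arrow from `x` to `1`; dividing by it turns `(x, a)`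
          -- into a pair with first entry `1`.
          let c : (resolution Γ).Ar := kerPairArrow (hp.trans (map_one (freeProj Γ)).symm)
          have hs : G.src (Hom.onAr q c) = G.src a := (Hom.src_onAr q c).trans h
          refine ⟨⟨a * (Hom.onAr q c)⁻¹, by simp [hs]⟩,
            QuotientGroup.eq.2 ((mem_range_mappingRel q).2 ⟨c, rfl, ?_, ?_⟩)⟩
          · change x = 1⁻¹ * x
            rw [inv_one, one_mul]
          · change _ = (a * (Hom.onAr q c)⁻¹)⁻¹ * a
            simp
      rightHom_surjective := fun γ => by
        obtain ⟨x, hx⟩ := freeProj_surjective γ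
        exact ⟨QuotientGroup.mk ⟨(x, G.idn (Hom.onOb q x)), (G.src_idn _).symm⟩, hx⟩ }
  ρ := QuotientGroup.lift _
    ((G.tgt.comp (MonoidHom.snd (resolution Γ).Ob G.Ar)).comp (mappingPairs q).subtype) (by
      rintro _ ⟨c, rfl⟩
      exact (Hom.tgt_onAr q c.1).trans
        ((congrArg (Hom.onOb q) (MonoidHom.mem_ker.1 c.2)).trans (map_one _)))
  ρ_inl α := rfl
  conj p α := by
    obtain ⟨⟨⟨x, a⟩, h⟩, rfl⟩ := QuotientGroup.mk_surjective p
    refine congrArg (QuotientGroup.mk (s := (mappingRel q).range)) (Subtype.ext (Prod.ext ?_ ?_))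
    · change (1 : (resolution Γ).Ob) = x⁻¹ * 1 * x
      simp
    · change (G.idn (G.tgt a))⁻¹ * α.1 * G.idn (G.tgt a) = a⁻¹ * α.1 * a
      -- The first factor ends at the identity object and `α` starts there, so `a` and the identity
      -- of its target act on `α` alike.
      have key := G.commute_of_tgt_src (a * (G.idn (G.tgt a))⁻¹) α.1 (by simp [G.tgt_idn]) α.2
      have e : (G.idn (G.tgt a))⁻¹ * α.1 * G.idn (G.tgt a) =
          a⁻¹ * (a * (G.idn (G.tgt a))⁻¹ * α.1) * G.idn (G.tgt a) := by group
      rw [e, key]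
      group
  induces p := by
    obtain ⟨⟨⟨x, a⟩, h⟩, rfl⟩ := QuotientGroup.mk_surjective p
    exact (toπ₁_eq_iff.2 ⟨a, (show Hom.onOb q x = G.src a from h).symm, rfl⟩).symm.trans (hq x)

end ofResolution

variable {χ : Γ →* G.π₁} (P Q : GExt χ)

theorem exists_inl_mul {x y : P.E} (h : P.ext.rightHom x = P.ext.rightHom y) :
    ∃ α, y = P.ext.inl α * x := by
  have hk : y * x⁻¹ ∈ P.ext.rightHom.ker := by
    rw [MonoidHom.mem_ker, map_mul, map_inv, h, mul_inv_cancel]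
  rw [← P.ext.range_inl_eq_ker_rightHom] at hk
  obtain ⟨α, hα⟩ := hk
  exact ⟨α, by rw [hα, inv_mul_cancel_right]⟩

theorem mul_inl (x : P.E) (α : G.G₂) : x * P.ext.inl α = P.ext.inl (P.ext.conjAct x α) * x := by
  rw [P.ext.inl_conjAct_comm, inv_mul_cancel_right]

/-! ### Comparing a diagram with the resolution -/

section lift

variable {P} (l : (resolution Γ).Ob →* P.E) (hl : ∀ x, P.ext.rightHom (l x) = freeProj Γ x)

include hl in
theorem exists_lift_arrow (c : (resolution Γ).Ar) :
    ∃ α, l ((resolution Γ).tgt c) = P.ext.inl α * l ((resolution Γ).src c) :=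
  P.exists_inl_mul (by rw [hl, hl]; exact map_src_eq_map_tgt c)

/-- The component in `G₂` of the image of an arrow of the resolution. -/
def liftFactor (c : (resolution Γ).Ar) : G.G₂ := (exists_lift_arrow l hl c).choose

theorem liftFactor_spec (c : (resolution Γ).Ar) :
    l ((resolution Γ).tgt c) = P.ext.inl (liftFactor l hl c) * l ((resolution Γ).src c) :=
  (exists_lift_arrow l hl c).choose_spec

/-- `G₂` acts freely on `E` by left multiplication. This uniqueness is what makes the lift to arrows
multiplicative. -/
theorem liftFactor_eq {c : (resolution Γ).Ar} {α : G.G₂}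
    (h : l ((resolution Γ).tgt c) = P.ext.inl α * l ((resolution Γ).src c)) :
    liftFactor l hl c = α :=
  P.ext.inl_injective (mul_right_cancel ((liftFactor_spec l hl c).symm.trans h))

/-- The image in `[G₂ → E]` of the arrows of the resolution. -/
def liftArrow : (resolution Γ).Ar →* G.G₂ ⋊[P.ext.conjAct] P.E :=
  MonoidHom.mk' (fun c => ⟨liftFactor l hl c, l ((resolution Γ).src c)⟩) fun c d => by
    refine SemidirectProduct.ext (liftFactor_eq l hl ?_) ?_
    · rw [SemidirectProduct.mul_left, map_mul P.ext.inl, P.ext.inl_conjAct_comm, map_mul,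
        map_mul, map_mul, map_mul, liftFactor_spec l hl c, liftFactor_spec l hl d]
      simp only [mul_assoc, inv_mul_cancel_left]
    · rw [SemidirectProduct.mul_right, map_mul, map_mul]

/-- The morphism from the resolution to `[G₂ → E]` given by a homomorphism on objects. -/
def liftTotal : resolution Γ ⟶ P.total :=
  Hom.mk' l (liftArrow l hl) (fun _ => rfl) (fun c => (liftFactor_spec l hl c).symm) fun x =>
    SemidirectProduct.ext (liftFactor_eq l hl (by
      rw [(resolution Γ).tgt_idn, (resolution Γ).src_idn]
      exact ((congrArg (· * l x) (map_one P.ext.inl)).trans (one_mul _)).symm))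
      (congrArg l ((resolution Γ).src_idn x))

theorem liftTotal_toDisc : liftTotal l hl ≫ P.toDisc = resolutionToDisc Γ :=
  hom_ext (MonoidHom.ext hl) (MonoidHom.ext fun _ => hl _)

/-- The lift is a morphism over `Γ` between the two denominators, so the fraction may be rewritten
with the resolution as denominator, whatever `l` is. -/
theorem hoHom_eq_fraction :
    P.hoHom = fraction resolutionToDisc_mem (liftTotal l hl ≫ P.toG) := by
  rw [eq_comm, fraction_eq_iff, ← liftTotal_toDisc l hl, Functor.map_comp, Functor.map_comp,
    Category.assoc]
  exact congrArg _ (toHo_comp_fraction P.toDisc_mem P.toG).symm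

theorem onAr_lift {c : (resolution Γ).Ar} {α : G.G₂}
    (h : l ((resolution Γ).tgt c) = P.ext.inl α * l ((resolution Γ).src c)) :
    Hom.onAr (liftTotal l hl ≫ P.toG) c = α.1 * G.idn (P.ρ (l ((resolution Γ).src c))) := by
  rw [← liftFactor_eq l hl h]
  rfl

end lift

theorem exists_lift :
    ∃ l : (resolution Γ).Ob →* P.E, ∀ x, P.ext.rightHom (l x) = freeProj Γ x :=
  ⟨genLift (Function.surjInv P.ext.rightHom_surjective),
    eq_of_gen (f := P.ext.rightHom.comp (genLift _)) (f' := freeProj Γ) fun γ => by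
      rw [MonoidHom.comp_apply, genLift_gen]
      exact (Function.surjInv_eq _ γ).trans (freeProj_gen γ).symm⟩

/-- The homomorphism sending `x` to the class of `x` with the identity arrow of `q x` lies over `Γ`;
the morphism to `G` obtained from it is `q` itself, not merely homotopic to it. -/
theorem hoHom_ofResolution (q : resolution Γ ⟶ G)
    (hq : ∀ x, G.toπ₁ (Hom.onOb q x) = χ (freeProj Γ x)) :
    (ofResolution q hq).hoHom = fraction resolutionToDisc_mem q := by
  let l : (resolution Γ).Ob →* (ofResolution q hq).E := (QuotientGroup.mk' _).comp
    (((MonoidHom.id _).prod (G.idn.comp (Hom.onOb q))).codRestrict (mappingPairs q) fun x =>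
      (G.src_idn _).symm)
  have hl : ∀ x, (ofResolution q hq).ext.rightHom (l x) = freeProj Γ x := fun _ => rfl
  have e : liftTotal l hl ≫ (ofResolution q hq).toG = q := by
    refine hom_ext (MonoidHom.ext fun x => G.tgt_idn _) (MonoidHom.ext fun c => ?_)
    have hs := Hom.src_onAr q c
    refine (onAr_lift l hl (c := c)
      (α := ⟨Hom.onAr q c * (G.idn (Hom.onOb q ((resolution Γ).src c)))⁻¹,
        by simp [hs, G.src_idn]⟩) ?_).trans ?_
    -- The relation is witnessed by the inverse of `c`, translated so that it ends at `1`.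
    · refine (QuotientGroup.eq.2 ((mem_range_mappingRel q).2
        ⟨((resolution Γ).idn ((resolution Γ).src c))⁻¹ * (resolution Γ).inv c, ?_, ?_, ?_⟩)).symm
      · rw [map_mul, tgt_inv, map_inv, (resolution Γ).tgt_idn, inv_mul_cancel]
      · rw [map_mul, src_inv, map_inv, (resolution Γ).src_idn]
        change _ = (1 * _)⁻¹ * _
        rw [one_mul]
        rfl
      · rw [map_mul, map_inv, Hom.onAr_inv, Hom.onAr_idn q, TwoGroup.inv]
        change (G.idn (Hom.onOb q ((resolution Γ).src c)))⁻¹ * (G.idn (G.src (Hom.onAr q c)) *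
          (Hom.onAr q c)⁻¹ * G.idn (G.tgt (Hom.onAr q c))) = (Hom.onAr q c * (G.idn (Hom.onOb q ((resolution Γ).src c)))⁻¹ *
          (G.idn (Hom.onOb q ((resolution Γ).src c))))⁻¹ *
            G.idn (Hom.onOb q ((resolution Γ).tgt c))
        rw [hs, Hom.tgt_onAr q]
        simp [mul_assoc]
    · change Hom.onAr q c * (G.idn (Hom.onOb q ((resolution Γ).src c)))⁻¹ *
        G.idn (G.tgt (G.idn (Hom.onOb q ((resolution Γ).src c)))) = _
      rw [G.tgt_idn, inv_mul_cancel_right]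
  rw [hoHom_eq_fraction l hl, e]

/-- Write `f` as a fraction over the resolution; the compatibility with `χ` needed to form its
diagram is the effect of `f` on `π₁`. -/
theorem exists_cls_eq (f : WeakMapClasses χ) : ∃ P : GExt χ, P.cls = f := by
  obtain ⟨q, hq⟩ := exists_fraction f.1
  refine ⟨ofResolution q fun x => ?_, Subtype.ext ((hoHom_ofResolution q _).trans hq)⟩
  have h := congrArg hoπ₁Map (toHo_comp_fraction resolutionToDisc_mem q)
  rw [hoπ₁Map_comp, hoπ₁Map_toHo, hoπ₁Map_toHo, hq] at h
  exact (DFunLike.congr_fun h ((resolution Γ).toπ₁ x)).symm.trans (f.2 _)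

/-! ### Twisted maps and equality of classes of diagrams -/

/-- Morphisms of diagrams twisted by a function `f` on pairs of elements of `Γ`: the maps
`φ : E → E'` over `Γ` that respect the action of `G₂` and the homomorphisms to `Ob`, and such that
`φ (x y) = f (x, y) φ(x) φ(y)`. -/
def Twisted (f : Γ → Γ → G.π₂) (P Q : GExt χ) : Prop :=
  ∃ φ : P.E → Q.E, (∀ α x, φ (P.ext.inl α * x) = Q.ext.inl α * φ x) ∧ (∀ x, Q.ρ (φ x) = P.ρ x) ∧
    (∀ x, Q.ext.rightHom (φ x) = P.ext.rightHom x) ∧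
    ∀ x y, φ (x * y) =
      Q.ext.inl (G.π₂ToG₂ (f (P.ext.rightHom x) (P.ext.rightHom y))) * (φ x * φ y)

variable {P Q}

/-- With trivial factor the map is a homomorphism, hence a morphism `[G₂ → E] → [G₂ → E']`
compatible with the projections to `Γ` and to `G`, so the fractions agree. -/
theorem cls_eq_of_twisted_one (h : Twisted 1 P Q) : P.cls = Q.cls := by
  obtain ⟨φ, h1, h2, h3, h4⟩ := h
  let φ' : P.E →* Q.E := MonoidHom.mk' φ fun x y => by simp [h4]
  have hinl : ∀ α, φ' (P.ext.inl α) = Q.ext.inl α := fun α => by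
    have := h1 α 1
    rw [mul_one] at this
    exact this.trans ((congrArg _ (map_one φ')).trans (mul_one _))
  let t : P.total ⟶ Q.total := Hom.mk' φ'
    (SemidirectProduct.map (MonoidHom.id _) φ' fun x => MonoidHom.ext fun α => by
      refine Subtype.ext ((P.conj_coe x α).trans ?_)
      rw [← h2]
      exact (Q.conj_coe (φ x) α).symm)
    (fun _ => rfl)
    (fun a => by
      change Q.ext.inl a.left * φ' a.right = φ' (P.ext.inl a.left * a.right)
      rw [map_mul, hinl])
    (fun x => SemidirectProduct.ext rfl rfl)
  have e1 : t ≫ Q.toDisc = P.toDisc := hom_ext (MonoidHom.ext h3) (MonoidHom.ext fun a => h3 _)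
  have e2 : t ≫ Q.toG = P.toG := hom_ext (MonoidHom.ext h2) (MonoidHom.ext fun a => by
    change a.left.1 * G.idn (Q.ρ (φ a.right)) = a.left.1 * G.idn (P.ρ a.right)
    rw [h2])
  refine Subtype.ext ((fraction_eq_iff P.toDisc_mem P.toG Q.hoHom).2 ?_)
  rw [← e1, ← e2, Functor.map_comp, Functor.map_comp, Category.assoc]
  exact congrArg _ (toHo_comp_fraction Q.toDisc_mem Q.toG).symm

/-- Lifting both diagrams to the resolution by `l` and `m` turns equality of classes into a homotopy
`θ`. Its components give elements `d w` of `G₂`, and the map sought is `α l(w) ↦ α d(w) m(w)`.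
Naturality of `θ` makes it well defined; multiplicativity of `θ` makes it a homomorphism. -/
theorem twisted_one_of_cls_eq (h : P.cls = Q.cls) : Twisted 1 P Q := by
  obtain ⟨l, hl⟩ := P.exists_lift
  obtain ⟨m, hm⟩ := Q.exists_lift
  have h' : P.hoHom = Q.hoHom := congrArg Subtype.val h
  rw [hoHom_eq_fraction l hl, hoHom_eq_fraction m hm] at h'
  obtain ⟨θ⟩ := homotopy_of_fraction_eq h'
  have hs : ∀ w, G.src (θ.arr w) = P.ρ (l w) := θ.src_arr
  have ht : ∀ w, G.tgt (θ.arr w) = Q.ρ (m w) := θ.tgt_arr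
  -- The inverse of `θ w` translated to start at the identity object, so that `∂(d w)` is the
  -- discrepancy between `ρ(l w)` and `ρ'(m w)`.
  let d (w : (resolution Γ).Ob) : G.G₂ :=
    ⟨G.idn (P.ρ (l w)) * (θ.arr w)⁻¹, by simp [hs, G.src_idn]⟩
  have hd : ∀ w, G.bd (d w) = P.ρ (l w) * (Q.ρ (m w))⁻¹ := fun w => by
    change G.tgt (G.idn (P.ρ (l w)) * (θ.arr w)⁻¹) = _
    rw [map_mul, map_inv, ht, G.tgt_idn]
  have key : ∀ u w u' w', P.ext.inl u * l w = P.ext.inl u' * l w' →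
      Q.ext.inl (u * d w) * m w = Q.ext.inl (u' * d w') * m w' := by
    intro u w u' w' e
    have hπ : freeProj Γ w = freeProj Γ w' := by
      have := congrArg P.ext.rightHom e
      simpa [hl] using this
    -- Two expressions of one element of `E` involve words over the same element of `Γ`; naturality
    -- at the arrow joining them gives the required relation between `d w` and `d w'`.
    let c : (resolution Γ).Ar := kerPairArrow hπ
    have hP := onAr_lift l hl (c := c) (α := u'⁻¹ * u) (by
      change l w' = P.ext.inl (u'⁻¹ * u) * l w
      rw [map_mul, mul_assoc, e, map_inv, inv_mul_cancel_left])
    obtain ⟨β, hβ⟩ := exists_lift_arrow m hm c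
    have hQ := onAr_lift m hm hβ
    have nat := θ.naturality c
    rw [hP, hQ, TwoGroup.cmp, TwoGroup.cmp, hs, map_mul G.src, G.src_idn, MonoidHom.mem_ker.1 β.2, one_mul] at nat
    change θ.arr w' * (G.idn (P.ρ (l w')))⁻¹ * ((u'⁻¹ * u).1 * G.idn (P.ρ (l w))) =
      β.1 * G.idn (Q.ρ (m w)) * (G.idn (Q.ρ (m w)))⁻¹ * θ.arr w at nat
    have e2 : u * d w = u' * d w' * β := by
      apply Subtype.ext
      change u.1 * (G.idn (P.ρ (l w)) * (θ.arr w)⁻¹) =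
        u'.1 * (G.idn (P.ρ (l w')) * (θ.arr w')⁻¹) * β.1
      rw [mul_inv_cancel_right, ← mul_inv_eq_iff_eq_mul] at nat
      rw [← nat]
      change _ = _ * (θ.arr w' * (G.idn (P.ρ (l w')))⁻¹ * ((u'.1⁻¹ * u.1) * _) * _)
      group
    change m w' = Q.ext.inl β * m w at hβ
    rw [e2, hβ, map_mul, mul_assoc]
  have hw : ∀ x : P.E, ∃ p : G.G₂ × (resolution Γ).Ob, x = P.ext.inl p.1 * l p.2 := fun x => by
    obtain ⟨w, hw⟩ := freeProj_surjective (P.ext.rightHom x)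
    obtain ⟨α, hα⟩ := P.exists_inl_mul ((hl w).trans hw)
    exact ⟨(α, w), hα⟩
  choose p hp using hw
  let φ (x : P.E) : Q.E := Q.ext.inl ((p x).1 * d (p x).2) * m (p x).2
  have hφ : ∀ u w, φ (P.ext.inl u * l w) = Q.ext.inl (u * d w) * m w := fun u w =>
    key _ _ _ _ (hp _).symm
  refine ⟨φ, fun α x => ?_, fun x => ?_, fun x => ?_, fun x y => ?_⟩
  · nth_rw 1 [hp x]
    rw [← mul_assoc, ← map_mul, hφ, mul_assoc, map_mul, mul_assoc]
  · nth_rw 2 [hp x]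
    simp only [φ, map_mul, Q.ρ_inl, P.ρ_inl, hd, mul_assoc, inv_mul_cancel, mul_one]
  · nth_rw 2 [hp x]
    simp only [φ, map_mul, Q.ext.rightHom_inl, P.ext.rightHom_inl, hl, hm, one_mul]
  · simp only [Pi.one_apply, map_one, one_mul]
    obtain ⟨⟨u, w⟩, rfl⟩ := Set.mem_range.1 (⟨p x, (hp x).symm⟩ :
      x ∈ Set.range fun p : G.G₂ × (resolution Γ).Ob => P.ext.inl p.1 * l p.2)
    obtain ⟨⟨v, z⟩, rfl⟩ := Set.mem_range.1 (⟨p y, (hp y).symm⟩ :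
      y ∈ Set.range fun p : G.G₂ × (resolution Γ).Ob => P.ext.inl p.1 * l p.2)
    have e : P.ext.inl u * l w * (P.ext.inl v * l z) =
        P.ext.inl (u * P.ext.conjAct (l w) v) * l (w * z) := by
      rw [mul_assoc, ← mul_assoc (l w), P.mul_inl, map_mul, map_mul]
      simp only [mul_assoc]
    have e' : Q.ext.inl (u * d w) * m w * (Q.ext.inl (v * d z) * m z) =
        Q.ext.inl (u * d w * Q.ext.conjAct (m w) (v * d z)) * m (w * z) := by
      rw [mul_assoc, ← mul_assoc (m w), Q.mul_inl, map_mul _ (u * d w), map_mul m]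
      simp only [mul_assoc]
    dsimp only
    rw [e, hφ, hφ, hφ, e']
    congr 2
    rw [mul_assoc, mul_assoc]
    congr 1
    apply Subtype.ext
    -- This arrow ends at the identity object and so commutes with `G₂`; hence conjugation by `m w`
    -- turns into conjugation by `l w` after multiplying by `d w`.
    have comm := G.commute_of_tgt_src ((θ.arr w)⁻¹ * G.idn (Q.ρ (m w))) (v * d z).1
      (by simp [ht, G.tgt_idn]) (v * d z).2
    change (P.ext.conjAct (l w) v).1 * (G.idn (P.ρ (l (w * z))) * (θ.arr (w * z))⁻¹) =
      G.idn (P.ρ (l w)) * (θ.arr w)⁻¹ * (Q.ext.conjAct (m w) (v * d z)).1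
    rw [P.conj_coe, Q.conj_coe]
    have comm' : G.idn (P.ρ (l w)) * (θ.arr w)⁻¹ *
        (G.idn (Q.ρ (m w)) * (v * d z).1 * (G.idn (Q.ρ (m w)))⁻¹) =
        G.idn (P.ρ (l w)) * ((v * d z).1 * (θ.arr w)⁻¹) := by
      have := congrArg (G.idn (P.ρ (l w)) * · * (G.idn (Q.ρ (m w)))⁻¹) comm
      simpa [mul_assoc] using this
    rw [comm']
    change _ = _ * (v.1 * (G.idn (P.ρ (l z)) * (θ.arr z)⁻¹) * _)
    simp [mul_assoc]

end GExt

/-! ### Cocycles and extensions by `π₂` -/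

section cocycle

variable {χ : Γ →* G.π₁}

/-- The multiplicative 2-cocycle condition. -/
def IsFactorSet (χ : Γ →* G.π₁) (f : Γ → Γ → G.π₂) : Prop :=
  ∀ g h j, f (g * h) j * f g h = G.actπ₂ (χ g) (f h j) * f g (h * j)

/-- A 2-cocycle as a function with values in the multiplicative group `π₂`. -/
def toFactorSet (z : groupCohomology.cocycles₂ (π₂Rep χ)) (g h : Γ) : G.π₂ :=
  Additive.toMul (z (g, h) : Additive G.π₂)

theorem isFactorSet_toFactorSet (z : groupCohomology.cocycles₂ (π₂Rep χ)) :
    IsFactorSet χ (toFactorSet z) := fun g h j =>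
  congrArg Additive.toMul ((groupCohomology.mem_cocycles₂_iff (A := π₂Rep χ) z).1 z.2 g h j)

theorem H2π_eq_iff_exists (z z' : groupCohomology.cocycles₂ (π₂Rep χ)) :
    groupCohomology.H2π (π₂Rep χ) z = groupCohomology.H2π (π₂Rep χ) z' ↔
      ∃ θ : Γ → G.π₂, ∀ g h, θ (g * h) * toFactorSet z g h =
        toFactorSet z' g h * (θ g * G.actπ₂ (χ g) (θ h)) := by
  rw [groupCohomology.H2π_eq_iff]
  -- The coboundary equation, with `a`, `b`, `c` standing for `g • θ h`, `θ (g * h)`, `θ g`,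
  -- rearranged without subtraction so that it can be read multiplicatively.
  have key : ∀ (a b c d e : Additive G.π₂), a - b + c = d - e ↔ b + d = e + (c + a) := by
    intro a b c d e
    constructor <;> intro h
    · rw [sub_eq_iff_eq_add.1 h.symm]
      abel
    · rw [eq_sub_iff_add_eq, ← add_right_inj b, h]
      abel
  constructor
  · rintro ⟨θ, hθ⟩
    refine ⟨fun g => Additive.toMul (θ g : Additive G.π₂), fun g h => ?_⟩
    exact congrArg Additive.toMul ((key _ _ _ _ _).1 (congrFun hθ (g, h)))
  · rintro ⟨θ, hθ⟩
    refine ⟨fun g => Additive.ofMul (θ g), funext fun p => ?_⟩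
    exact (key _ _ _ _ _).2 (congrArg Additive.ofMul (hθ p.1 p.2))

namespace ModuleExt

/-- The factor set of an extension as a 2-cocycle. -/
def cocycle (X : ModuleExt χ) : groupCohomology.cocycles₂ (π₂Rep χ) :=
  ⟨fun p => Additive.ofMul (X.factor p.1 p.2),
    (groupCohomology.mem_cocycles₂_iff (A := π₂Rep χ) _).2
      fun g h j => congrArg Additive.ofMul (X.factor_cocycle g h j)⟩

theorem H2π_cocycle (X : ModuleExt χ) : groupCohomology.H2π (π₂Rep χ) X.cocycle = X.cls := rfl

theorem toFactorSet_cocycle (X : ModuleExt χ) : toFactorSet X.cocycle = X.factor := rfl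

/-- Two sections differ by a function `θ` with values in `π₂`, and their factor sets by its
coboundary. So the class may be computed with any convenient section. -/
theorem cls_eq_of_section (X : ModuleExt χ) (z : groupCohomology.cocycles₂ (π₂Rep χ)) (s : Γ → X.K)
    (hs : ∀ γ, X.ext.rightHom (s γ) = γ)
    (hz : ∀ g h, X.ext.inl (toFactorSet z g h) * s (g * h) = s g * s h) :
    X.cls = groupCohomology.H2π (π₂Rep χ) z := by
  have hθ : ∀ g, ∃ a, s g = X.ext.inl a * X.sec g := fun g => by
    have : s g * (X.sec g)⁻¹ ∈ X.ext.rightHom.ker := by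
      rw [MonoidHom.mem_ker, map_mul, map_inv, hs, rightHom_sec, mul_inv_cancel]
    rw [← X.ext.range_inl_eq_ker_rightHom] at this
    obtain ⟨a, ha⟩ := this
    exact ⟨a, by rw [ha, inv_mul_cancel_right]⟩
  choose θ hθ using hθ
  rw [eq_comm, ← H2π_cocycle, H2π_eq_iff_exists]
  refine ⟨θ, fun g h => ?_⟩
  rw [toFactorSet_cocycle]
  have e := hz g h
  have c := X.conj (X.sec g) (θ h)
  rw [rightHom_sec] at c
  rw [hθ, hθ g, hθ h, ← mul_assoc, ← map_mul] at e
  have e' : X.ext.inl (θ g) * X.sec g * (X.ext.inl (θ h) * X.sec h) =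
      X.ext.inl (θ g * G.actπ₂ (χ g) (θ h) * X.factor g h) * X.sec (g * h) := by
    rw [map_mul, map_mul, mul_assoc _ _ (X.sec (g * h)), factor_spec, c]
    group
  rw [e'] at e
  rw [mul_comm (θ _), X.ext.inl_injective (mul_right_cancel e), mul_comm]

/-! ### The extension defined by a factor set -/

/-- The underlying set of the extension with a given factor set. -/
@[ext]
structure FactorSetGroup (f : Γ → Γ → G.π₂) (hf : IsFactorSet χ f) : Type u where
  fst : G.π₂
  snd : Γ

namespace FactorSetGroup

variable {f : Γ → Γ → G.π₂} (hf : IsFactorSet χ f)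

include hf in
theorem factor_one_left (g : Γ) : f 1 g = f 1 1 := by
  have := hf 1 1 g
  simp only [mul_one, one_mul, map_one, MulAut.one_apply] at this
  exact (mul_left_cancel this).symm

include hf in
theorem factor_one_right (g : Γ) : f g 1 = G.actπ₂ (χ g) (f 1 1) := by
  have := hf g 1 1
  simp only [mul_one] at this
  exact mul_right_cancel this

instance : Group (FactorSetGroup f hf) :=
  letI : Mul (FactorSetGroup f hf) :=
    ⟨fun x y => ⟨x.fst * G.actπ₂ (χ x.snd) y.fst * f x.snd y.snd, x.snd * y.snd⟩⟩
  -- Factor sets are not assumed normalised, so the unit and the inclusion of `π₂` are corrected by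
  -- `f 1 1`.
  letI : One (FactorSetGroup f hf) := ⟨⟨(f 1 1)⁻¹, 1⟩⟩
  letI : Inv (FactorSetGroup f hf) :=
    ⟨fun x => ⟨(f 1 1)⁻¹ * (f x.snd⁻¹ x.snd)⁻¹ * (G.actπ₂ (χ x.snd⁻¹) x.fst)⁻¹, x.snd⁻¹⟩⟩
  Group.ofLeftAxioms
    (fun x y z => by
      obtain ⟨a, g⟩ := x
      obtain ⟨b, h⟩ := y
      obtain ⟨c, j⟩ := z
      refine FactorSetGroup.ext ?_ (mul_assoc g h j)
      change a * G.actπ₂ (χ g) b * f g h * G.actπ₂ (χ (g * h)) c * f (g * h) j =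
        a * G.actπ₂ (χ g) (b * G.actπ₂ (χ h) c * f h j) * f g (h * j)
      have key := hf g h j
      rw [map_mul χ, map_mul G.actπ₂, MulAut.mul_apply, map_mul, map_mul]
      calc _ = a * G.actπ₂ (χ g) b * G.actπ₂ (χ g) (G.actπ₂ (χ h) c) *
            (f (g * h) j * f g h) := by simp only [mul_assoc, mul_left_comm, mul_comm]
        _ = _ := by rw [key]; simp only [mul_assoc])
    (fun x => by
      obtain ⟨a, g⟩ := x
      refine FactorSetGroup.ext ?_ (one_mul g)
      change (f 1 1)⁻¹ * G.actπ₂ (χ 1) a * f 1 g = a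
      rw [factor_one_left hf g, map_one, map_one, MulAut.one_apply, mul_comm, mul_inv_cancel_left])
    (fun x => by
      obtain ⟨a, g⟩ := x
      refine FactorSetGroup.ext ?_ (inv_mul_cancel g)
      change (f 1 1)⁻¹ * (f g⁻¹ g)⁻¹ * (G.actπ₂ (χ g⁻¹) a)⁻¹ * G.actπ₂ (χ g⁻¹) a * f g⁻¹ g =
        (f 1 1)⁻¹
      simp)

theorem mul_def (x y : FactorSetGroup f hf) :
    x * y = ⟨x.fst * G.actπ₂ (χ x.snd) y.fst * f x.snd y.snd, x.snd * y.snd⟩ := rfl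

/-- The inclusion of `π₂`. -/
def inl : G.π₂ →* FactorSetGroup f hf :=
  MonoidHom.mk' (fun a => ⟨a * (f 1 1)⁻¹, 1⟩) fun a b => by
    simp [mul_def, mul_assoc, mul_left_comm]

theorem inl_mul (a b : G.π₂) (g : Γ) :
    inl hf a * (⟨b, g⟩ : FactorSetGroup f hf) = ⟨a * b, g⟩ := by
  refine FactorSetGroup.ext ?_ (one_mul g)
  change a * (f 1 1)⁻¹ * G.actπ₂ (χ 1) b * f 1 g = a * b
  rw [factor_one_left hf g, map_one, map_one, MulAut.one_apply, mul_right_comm,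
    inv_mul_cancel_right]

theorem mul_inl (a b : G.π₂) (g : Γ) :
    (⟨b, g⟩ : FactorSetGroup f hf) * inl hf a = ⟨b * G.actπ₂ (χ g) a, g⟩ := by
  refine FactorSetGroup.ext ?_ (mul_one g)
  change b * G.actπ₂ (χ g) (a * (f 1 1)⁻¹) * f g 1 = b * G.actπ₂ (χ g) a
  rw [factor_one_right hf g, map_mul, map_inv, ← mul_assoc, inv_mul_cancel_right]

end FactorSetGroup

/-- The extension with a given factor set. -/
def ofFactorSet {f : Γ → Γ → G.π₂} (hf : IsFactorSet χ f) : ModuleExt χ where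
  K := FactorSetGroup f hf
  ext :=
    { inl := FactorSetGroup.inl hf
      rightHom := MonoidHom.mk' FactorSetGroup.snd fun _ _ => rfl
      inl_injective := fun _ _ h => mul_right_cancel (congrArg FactorSetGroup.fst h)
      range_inl_eq_ker_rightHom := by
        apply le_antisymm
        · rintro _ ⟨a, rfl⟩
          rfl
        · rintro ⟨a, g⟩ h
          obtain rfl : g = 1 := h
          exact ⟨a * f 1 1, FactorSetGroup.ext (mul_inv_cancel_right _ _) rfl⟩
      rightHom_surjective := fun γ => ⟨⟨1, γ⟩, rfl⟩ }
  conj x a := by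
    obtain ⟨b, g⟩ := x
    rw [eq_mul_inv_iff_mul_eq]
    exact (FactorSetGroup.inl_mul hf _ _ _).trans
      ((FactorSetGroup.mul_inl hf _ _ _).trans (by rw [mul_comm]; rfl)).symm

/-- In the extension built from a cocycle, the section `γ ↦ (1, γ)` has that very cocycle as its
factor set. -/
theorem exists_cls_eq (c : H2π₂ χ) : ∃ X : ModuleExt χ, X.cls = c := by
  induction c using groupCohomology.H2_induction_on with | _ z
  refine ⟨ofFactorSet (isFactorSet_toFactorSet z),
    cls_eq_of_section _ z (fun γ => ⟨1, γ⟩) (fun _ => rfl) fun g h => ?_⟩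
  refine (FactorSetGroup.inl_mul _ _ _ _).trans (FactorSetGroup.ext ?_ rfl)
  change _ * 1 = 1 * G.actπ₂ (χ g) 1 * toFactorSet z g h
  rw [map_one, mul_one, one_mul, one_mul]

end ModuleExt

end cocycle

/-! ### Calculus of twisted maps -/

namespace GExt

variable {χ : Γ →* G.π₁} {P Q R : GExt χ}

/-- The inclusion of `π₂` in the group of a diagram. -/
def inlπ₂ (P : GExt χ) : G.π₂ →* P.E := P.ext.inl.comp G.π₂ToG₂

/-- `π₂` is central in `G₂`: arrows ending at the identity object commute with arrows starting
there. -/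
theorem inlπ₂_mul_inl (a : G.π₂) (α : G.G₂) :
    P.inlπ₂ a * P.ext.inl α = P.ext.inl α * P.inlπ₂ a := by
  have : G.π₂ToG₂ a * α = α * G.π₂ToG₂ a :=
    Subtype.ext (G.commute_of_tgt_src a.1 α.1 a.2.2 α.2)
  change P.ext.inl _ * _ = _ * P.ext.inl _
  rw [← map_mul, this, map_mul]

theorem mul_inlπ₂ (x : P.E) (a : G.π₂) :
    x * P.inlπ₂ a = P.inlπ₂ (G.actπ₂ (χ (P.ext.rightHom x)) a) * x := by
  have := P.conj_π₂ x a
  rw [eq_mul_inv_iff_mul_eq] at this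
  exact this.symm

theorem ρ_inlπ₂ (a : G.π₂) : P.ρ (P.inlπ₂ a) = 1 := P.ρ_π₂ a

theorem rightHom_inlπ₂ (a : G.π₂) : P.ext.rightHom (P.inlπ₂ a) = 1 := P.ext.rightHom_inl _

theorem Twisted.trans {f f' : Γ → Γ → G.π₂} (h : Twisted f P Q) (h' : Twisted f' Q R) :
    Twisted (f * f') P R := by
  obtain ⟨φ, h1, h2, h3, h4⟩ := h
  obtain ⟨ψ, k1, k2, k3, k4⟩ := h'
  refine ⟨ψ ∘ φ, fun α x => ?_, fun x => ?_, fun x => ?_, fun x y => ?_⟩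
  · simp [h1, k1]
  · simp [h2, k2]
  · simp [h3, k3]
  · simp only [Function.comp_apply, Pi.mul_apply]
    rw [h4, k1, k4, h3, h3, map_mul, map_mul, mul_assoc]

/-- A twisted map is `G₂`-equivariant over `Γ`, and the fibres over `Γ` are torsors under `G₂`, so
it is bijective. -/
theorem Twisted.symm {f : Γ → Γ → G.π₂} (h : Twisted f P Q) : Twisted f⁻¹ Q P := by
  obtain ⟨φ, h1, h2, h3, h4⟩ := h
  have hinj : Function.Injective φ := fun x y hxy => by
    obtain ⟨α, rfl⟩ := P.exists_inl_mul (x := x) (y := y) (by rw [← h3, ← h3, hxy])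
    rw [h1, right_eq_mul, map_eq_one_iff _ Q.ext.inl_injective] at hxy
    rw [hxy, map_one, one_mul]
  have hsurj : Function.Surjective φ := fun y => by
    obtain ⟨x, hx⟩ := P.ext.rightHom_surjective (Q.ext.rightHom y)
    obtain ⟨α, rfl⟩ := Q.exists_inl_mul ((h3 x).trans hx)
    exact ⟨P.ext.inl α * x, h1 α x⟩
  choose ψ hψ using hsurj
  have h3' : ∀ x, P.ext.rightHom (ψ x) = Q.ext.rightHom x := fun x => by rw [← h3, hψ]
  refine ⟨ψ, fun α x => hinj ?_, fun x => ?_, h3', fun x y => hinj ?_⟩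
  · rw [h1, hψ, hψ]
  · rw [← h2, hψ]
  · rw [h1, h4, hψ, hψ, hψ, h3', h3', Pi.inv_apply, Pi.inv_apply, map_inv, map_inv,
      inv_mul_cancel_left]

/-- Multiply `φ` by `θ` of the image in `Γ`. Equivariance survives because `π₂` is central in `G₂`,
and compatibility with `ρ` because `ρ` kills `π₂`. -/
theorem Twisted.of_coboundary {f f' : Γ → Γ → G.π₂} (h : Twisted f P Q) (θ : Γ → G.π₂)
    (hθ : ∀ g h, θ (g * h) * f g h = f' g h * (θ g * G.actπ₂ (χ g) (θ h))) : Twisted f' P Q := by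
  obtain ⟨φ, h1, h2, h3, h4⟩ := h
  refine ⟨fun x => Q.inlπ₂ (θ (P.ext.rightHom x)) * φ x, fun α x => ?_, fun x => ?_, fun x => ?_,
    fun x y => ?_⟩
  · dsimp only
    rw [h1, ← mul_assoc, inlπ₂_mul_inl, mul_assoc, map_mul, P.ext.rightHom_inl, one_mul]
  · rw [map_mul, ρ_inlπ₂, one_mul, h2]
  · rw [map_mul, rightHom_inlπ₂, one_mul, h3]
  · change _ * φ _ = Q.inlπ₂ _ * _
    have e : φ (x * y) = Q.inlπ₂ (f (P.ext.rightHom x) (P.ext.rightHom y)) * (φ x * φ y) := h4 x y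
    rw [e, ← mul_assoc, ← map_mul Q.inlπ₂, map_mul P.ext.rightHom, hθ, map_mul Q.inlπ₂,
      map_mul Q.inlπ₂]
    have e' := mul_inlπ₂ (φ x) (θ (P.ext.rightHom y))
    rw [h3] at e'
    simp only [mul_assoc]
    rw [← mul_assoc (φ x), e', mul_assoc]

/-- Pair `x` with the chosen section at its image in `Γ`. The failure of the section to be
multiplicative is the factor set, and the diagonal relation moves it from `K` to `E`. -/
theorem twisted_baer (P : GExt χ) (X : ModuleExt χ) : Twisted X.factor P (P.baer X) := by
  have hs : ∀ x, P.ext.rightHom x = X.ext.rightHom (X.sec (P.ext.rightHom x)) := fun x =>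
    (X.rightHom_sec _).symm
  let φ (x : P.E) : P.baerPairs X ⧸ (P.baerDiag X).range :=
    QuotientGroup.mk ⟨(x, X.sec (P.ext.rightHom x)), hs x⟩
  refine ⟨φ, fun α x => ?_, fun x => rfl, fun x => rfl, fun x y => ?_⟩
  · refine congrArg QuotientGroup.mk (Subtype.ext (Prod.ext rfl ?_))
    change X.sec (P.ext.rightHom (P.ext.inl α * x)) = 1 * X.sec (P.ext.rightHom x)
    rw [map_mul, P.ext.rightHom_inl, one_mul, one_mul]
  -- Coset equality asks for a diagonal element on the right, while the factor stands on the left;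
  -- hence its conjugate by the inverse of `x * y`.
  · refine QuotientGroup.eq.2 ⟨G.actπ₂ (χ (P.ext.rightHom (x * y)⁻¹))
      (X.factor (P.ext.rightHom x) (P.ext.rightHom y)), Subtype.ext (Prod.ext ?_ ?_)⟩
    · refine (P.conj_π₂ _ _).trans ?_
      change _ = (x * y)⁻¹ * (P.ext.inl _ * (x * y))
      rw [inv_inv, mul_assoc]
    · change X.ext.inl _ = (X.sec (P.ext.rightHom (x * y)))⁻¹ *
        (1 * (X.sec (P.ext.rightHom x) * X.sec (P.ext.rightHom y)))
      rw [one_mul, ← X.factor_spec, ← map_mul]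
      have c := X.conj (X.sec (P.ext.rightHom (x * y)))⁻¹
        (X.factor (P.ext.rightHom x) (P.ext.rightHom y))
      rw [map_inv, X.rightHom_sec, ← map_inv, inv_inv] at c
      rw [c, mul_assoc]

/-- Represent the section of the difference extension by pairs `(a γ, b γ)`. Every element of `E` is
uniquely `α a(γ)`, and the map sends it to `α b(γ)`; it respects the homomorphisms to `Ob` because
`ρ(a γ) = ρ'(b γ)`. -/
theorem twisted_difference (P Q : GExt χ) : Twisted (P.difference Q).factor P Q := by
  choose p hp using fun γ => QuotientGroup.mk_surjective ((P.difference Q).sec γ :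
    P.diffPairs Q ⧸ (P.diffDiag Q).range)
  let a (γ : Γ) : P.E := (p γ).1.1
  let b (γ : Γ) : Q.E := (p γ).1.2
  have hab : ∀ γ, P.ext.rightHom (a γ) = Q.ext.rightHom (b γ) := fun γ => congrArg Prod.fst (p γ).2
  have hρ : ∀ γ, P.ρ (a γ) = Q.ρ (b γ) := fun γ => congrArg Prod.snd (p γ).2
  have ha : ∀ γ, P.ext.rightHom (a γ) = γ := fun γ =>
    (congrArg (P.difference Q).ext.rightHom (hp γ)).trans ((P.difference Q).rightHom_sec γ)
  have hconj : ∀ γ α, P.ext.conjAct (a γ) α = Q.ext.conjAct (b γ) α := fun γ α => by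
    apply Subtype.ext
    rw [P.conj_coe, Q.conj_coe, hρ]
  -- Products of representatives are determined modulo the diagonal, so the same `β` occurs in both
  -- coordinates, while the factor enters only the first.
  have hmul : ∀ g h, ∃ β, a g * a h =
      P.inlπ₂ ((P.difference Q).factor g h) * (P.ext.inl β * a (g * h)) ∧
      b g * b h = Q.ext.inl β * b (g * h) := fun g h => by
    have e : QuotientGroup.mk (s := (P.diffDiag Q).range)
        (P.diffInl Q ((P.difference Q).factor g h) * p (g * h)) =
        QuotientGroup.mk (p g * p h) := by
      have := (P.difference Q).factor_spec g h
      rw [← hp, ← hp, ← hp] at this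
      exact this
    obtain ⟨β, hβ⟩ := QuotientGroup.eq.1 e
    have e1 : P.ext.inl β = (P.inlπ₂ ((P.difference Q).factor g h) * a (g * h))⁻¹ * (a g * a h) :=
      congrArg (fun p => p.1.1) hβ
    have e2 : Q.ext.inl β = (1 * b (g * h))⁻¹ * (b g * b h) := congrArg (fun p => p.1.2) hβ
    refine ⟨P.ext.conjAct (a (g * h)) β, ?_, ?_⟩
    · rw [← P.mul_inl, e1]
      group
    · rw [hconj, ← Q.mul_inl, e2]
      group
  choose u hu using fun x => P.exists_inl_mul (ha (P.ext.rightHom x))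
  let φ (x : P.E) : Q.E := Q.ext.inl (u x) * b (P.ext.rightHom x)
  have hr : ∀ α γ, P.ext.rightHom (P.ext.inl α * a γ) = γ := fun α γ => by
    rw [map_mul, P.ext.rightHom_inl, one_mul, ha]
  have hφ : ∀ α γ, φ (P.ext.inl α * a γ) = Q.ext.inl α * b γ := fun α γ => by
    have e := hu (P.ext.inl α * a γ)
    rw [hr] at e
    simp only [φ]
    rw [← P.ext.inl_injective (mul_right_cancel e), hr]
  refine ⟨φ, fun α x => ?_, fun x => ?_, fun x => ?_, fun x y => ?_⟩
  · nth_rw 1 [hu x]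
    rw [← mul_assoc, ← map_mul, hφ, map_mul, mul_assoc]
  · nth_rw 2 [hu x]
    simp only [φ, map_mul, Q.ρ_inl, P.ρ_inl, hρ]
  · nth_rw 2 [hu x]
    simp only [φ, map_mul, Q.ext.rightHom_inl, P.ext.rightHom_inl, hab]
  · obtain ⟨β, h1, h2⟩ := hmul (P.ext.rightHom x) (P.ext.rightHom y)
    have e : x * y = P.ext.inl (u x * P.ext.conjAct (a (P.ext.rightHom x)) (u y) *
        G.π₂ToG₂ ((P.difference Q).factor (P.ext.rightHom x) (P.ext.rightHom y)) * β) *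
        a (P.ext.rightHom x * P.ext.rightHom y) := by
      calc x * y = P.ext.inl (u x) * (a (P.ext.rightHom x) * P.ext.inl (u y)) *
            a (P.ext.rightHom y) := by
            nth_rw 1 [hu x, hu y]
            simp only [mul_assoc]
        _ = P.ext.inl (u x * P.ext.conjAct (a (P.ext.rightHom x)) (u y)) *
            (a (P.ext.rightHom x) * a (P.ext.rightHom y)) := by
            rw [P.mul_inl, map_mul]
            simp only [mul_assoc]
        _ = _ := by
            rw [h1]
            simp only [map_mul, mul_assoc]
            rfl
    have e' : φ x * φ y = Q.ext.inl (u x * P.ext.conjAct (a (P.ext.rightHom x)) (u y) * β) *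
        b (P.ext.rightHom x * P.ext.rightHom y) := by
      calc φ x * φ y = Q.ext.inl (u x) * (b (P.ext.rightHom x) * Q.ext.inl (u y)) *
            b (P.ext.rightHom y) := by
            simp only [φ, mul_assoc]
        _ = Q.ext.inl (u x * P.ext.conjAct (a (P.ext.rightHom x)) (u y)) *
            (b (P.ext.rightHom x) * b (P.ext.rightHom y)) := by
            rw [Q.mul_inl, hconj, map_mul]
            simp only [mul_assoc]
        _ = _ := by
            rw [h2]
            simp only [map_mul, mul_assoc]
    rw [e', e, hφ, map_mul, map_mul _ _ (G.π₂ToG₂ _)]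
    change _ * Q.inlπ₂ _ * _ * _ = Q.inlπ₂ _ * _
    rw [← inlπ₂_mul_inl, map_mul _ _ β]
    simp only [mul_assoc]

/-! ### Cohomology classes relating diagrams -/

/-- A cohomology class carries one diagram to another. -/
def Carries (c : H2π₂ χ) (P Q : GExt χ) : Prop :=
  ∃ z, groupCohomology.H2π (π₂Rep χ) z = c ∧ Twisted (toFactorSet z) P Q

/-- A representative of `0` is a coboundary and can be absorbed into the map, leaving an honest
isomorphism of diagrams. -/
theorem carries_zero_iff : Carries 0 P Q ↔ P.cls = Q.cls := by
  constructor
  · rintro ⟨z, hz, h⟩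
    rw [← map_zero (groupCohomology.H2π (π₂Rep χ)).hom] at hz
    obtain ⟨θ, hθ⟩ := (H2π_eq_iff_exists z 0).1 hz
    exact cls_eq_of_twisted_one (h.of_coboundary θ hθ)
  · intro h
    exact ⟨0, map_zero (groupCohomology.H2π (π₂Rep χ)).hom, twisted_one_of_cls_eq h⟩

theorem Carries.trans {c c' : H2π₂ χ} (h : Carries c P Q) (h' : Carries c' Q R) :
    Carries (c + c') P R := by
  obtain ⟨z, rfl, h⟩ := h
  obtain ⟨z', rfl, h'⟩ := h'
  exact ⟨z + z', map_add (groupCohomology.H2π (π₂Rep χ)).hom z z', h.trans h'⟩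

theorem Carries.symm {c : H2π₂ χ} (h : Carries c P Q) : Carries (-c) Q P := by
  obtain ⟨z, rfl, h⟩ := h
  exact ⟨-z, map_neg (groupCohomology.H2π (π₂Rep χ)).hom z, h.symm⟩

theorem carries_baer (P : GExt χ) (X : ModuleExt χ) : Carries X.cls P (P.baer X) :=
  ⟨X.cocycle, X.H2π_cocycle, P.twisted_baer X⟩

theorem carries_difference (P Q : GExt χ) : Carries (P.difference Q).cls P Q :=
  ⟨_, (P.difference Q).H2π_cocycle, P.twisted_difference Q⟩

/-- Going from `Q` back to `P`, across to `P'` and on to `Q'` has total class `-c + 0 + c`. This is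
why the action is well defined. -/
theorem Carries.cls_eq {P' Q' : GExt χ} {c : H2π₂ χ} (h : Carries c P Q) (h' : Carries c P' Q')
    (e : P.cls = P'.cls) : Q.cls = Q'.cls := by
  have := (h.symm.trans (carries_zero_iff.2 e)).trans h'
  rwa [add_zero, neg_add_cancel, carries_zero_iff] at this

end GExt

/-! ### The action of `H²(Γ, π₂)` -/

section action

variable {χ : Γ →* G.π₁}

/-- The action of a cohomology class on a homotopy class of weak maps. -/
def weakMapVAdd (c : H2π₂ χ) (f : WeakMapClasses χ) : WeakMapClasses χ :=
  ((GExt.exists_cls_eq f).choose.baer (ModuleExt.exists_cls_eq c).choose).cls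

/-- Makes the chosen representatives in `weakMapVAdd` irrelevant: any diagram to which `c` carries
`P` computes the action. -/
theorem GExt.Carries.vadd_eq {c : H2π₂ χ} {P Q : GExt χ} (h : GExt.Carries c P Q) :
    weakMapVAdd c P.cls = Q.cls := by
  have h' := GExt.carries_baer (GExt.exists_cls_eq P.cls).choose (ModuleExt.exists_cls_eq c).choose
  rw [(ModuleExt.exists_cls_eq c).choose_spec] at h'
  exact h'.cls_eq h (GExt.exists_cls_eq P.cls).choose_spec

/-- The action of `H²(Γ, π₂)` on the homotopy classes of weak maps. -/
abbrev weakMapAddAction (χ : Γ →* G.π₁) : AddAction (H2π₂ χ) (WeakMapClasses χ) where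
  vadd := weakMapVAdd
  zero_vadd f := by
    obtain ⟨P, rfl⟩ := GExt.exists_cls_eq f
    exact (GExt.carries_zero_iff.2 rfl).vadd_eq
  add_vadd c c' f := by
    obtain ⟨P, rfl⟩ := GExt.exists_cls_eq f
    obtain ⟨X, rfl⟩ := ModuleExt.exists_cls_eq c
    obtain ⟨X', rfl⟩ := ModuleExt.exists_cls_eq c'
    have h' := P.carries_baer X'
    have h := (P.baer X').carries_baer X
    change weakMapVAdd _ _ = weakMapVAdd _ (weakMapVAdd _ _)
    rw [h'.vadd_eq, h.vadd_eq, add_comm, (h'.trans h).vadd_eq]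

end action

end

theorem theorem14p6 (Γ : Type u) [Group Γ] (G : TwoGroup.{u}) (χ : Γ →* G.π₁) :
    (∀ f : WeakMapClasses χ, ∃ P : GExt χ, P.cls = f) ∧
    (∀ c : H2π₂ χ, ∃ X : ModuleExt χ, X.cls = c) ∧
    (IsEmpty (WeakMapClasses χ) ∨
      ∃ _action : AddAction (H2π₂ χ) (WeakMapClasses χ),
        (∀ (P : GExt χ) (X : ModuleExt χ), X.cls +ᵥ P.cls = (P.baer X).cls) ∧
        (∀ P Q : GExt χ, (P.difference Q).cls +ᵥ P.cls = Q.cls) ∧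
        AddAction.IsPretransitive (H2π₂ χ) (WeakMapClasses χ)) := by
  let action := weakMapAddAction χ
  -- The construction makes sense on the empty set too, so the second alternative always holds.
  refine ⟨GExt.exists_cls_eq, ModuleExt.exists_cls_eq, Or.inr ⟨action,
    fun P X => (P.carries_baer X).vadd_eq, fun P Q => (P.carries_difference Q).vadd_eq,
    ⟨fun f f' => ?_⟩⟩⟩
  obtain ⟨P, rfl⟩ := GExt.exists_cls_eq f
  obtain ⟨Q, rfl⟩ := GExt.exists_cls_eq f'
  exact ⟨(P.difference Q).cls, (P.carries_difference Q).vadd_eq⟩
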